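/- Consider a finite graph together with a colouring of its edges with two colours. A path is a *rainbow path* if its edges have pairwise distinct colours. An unordered pair of distinct non-adjacent vertices is called *dangerous* if it is joined by at most $66$ rainbow paths of length $2$, and *sparsely connected* if it is joined by at most $66$ paths of length $2$ (rainbow or otherwise). A graph $G$ has *property $\mathcal M$* if it has a spanning subgraph $H$ (that is, $V(H)=V(G)$ and $E(H)\subseteq E(G)$) with an edge 2-colouring such that, with adjacency, paths and colours all taken in $H$, 1. every vertex is in at most $3$ dangerous pairs; 2. every vertex is joined by edges to both vertices of at most $15$ dangerous pairs; 3. every vertex is in at most one sparsely connected pair. Let $\mathcal G(n,p)$ denote the random graph on $n$ labelled vertices in which each of the $\binom n2$ potential edges is present independently with probability $p$. If $p=p(n)=\sqrt{\frac{1.99\log n}{n}}$ (where $\log$ is the natural logarithm) and $G\sim\mathcal G(n,p)$, then $$\lim_{n\to\infty}\mathbb P\bigl(G\text{ has property }\mathcal M\bigr)=1 .$$ -/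

import Mathlib

open Filter Topology

namespace RainbowGraph

variable {V : Type*}

/-- A path in an edge-coloured graph `H` is a rainbow path if its edges have pairwise distinct
colours. -/
def IsRainbow {H : SimpleGraph V} {K : Type*} (C : H.EdgeLabeling K) {v w : V} (p : H.Path v w) :
    Prop :=
  ∀ (e f : Sym2 V) (he : e ∈ p.1.edges) (hf : f ∈ p.1.edges), e ≠ f →
    C ⟨e, p.1.edges_subset_edgeSet he⟩ ≠ C ⟨f, p.1.edges_subset_edgeSet hf⟩

/-- The set of paths of length `2` in `H` joining `v` and `w`. -/
def twoPaths (H : SimpleGraph V) (v w : V) : Set (H.Path v w) :=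
  {p | p.1.length = 2}

/-- The set of rainbow paths of length `2` in the edge-coloured graph `H` joining `v` and `w`. -/
def rainbowTwoPaths {H : SimpleGraph V} {K : Type*} (C : H.EdgeLabeling K) (v w : V) :
    Set (H.Path v w) :=
  {p | p ∈ twoPaths H v w ∧ IsRainbow C p}

/-- The set of dangerous pairs of an edge-coloured graph `H`: the unordered pairs of distinct
non-adjacent vertices joined by at most `66` rainbow paths of length `2`. -/
def dangerousPairs {H : SimpleGraph V} {K : Type*} (C : H.EdgeLabeling K) : Set (Sym2 V) :=
  {e | ∃ v w : V, e = s(v, w) ∧ v ≠ w ∧ ¬ H.Adj v w ∧ (rainbowTwoPaths C v w).encard ≤ 66}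

/-- The set of sparsely connected pairs of a graph `H`: the unordered pairs of distinct
non-adjacent vertices joined by at most `66` paths of length `2` (rainbow or otherwise). -/
def sparselyConnectedPairs (H : SimpleGraph V) : Set (Sym2 V) :=
  {e | ∃ v w : V, e = s(v, w) ∧ v ≠ w ∧ ¬ H.Adj v w ∧ (twoPaths H v w).encard ≤ 66}

/-- Property `M`: there are a spanning subgraph `H` of `G` and an edge 2-colouring `C` of `H` such
that, in `H` with the colouring `C`, every vertex is in at most `3` dangerous pairs, every vertex
is joined by edges to both vertices of at most `15` dangerous pairs, and every vertex is in at most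
one sparsely connected pair. -/
def PropertyM (G : SimpleGraph V) : Prop :=
  ∃ (H : SimpleGraph V) (C : H.EdgeLabeling (Fin 2)), H ≤ G ∧
    (∀ v : V, {e | e ∈ dangerousPairs C ∧ v ∈ e}.encard ≤ 3) ∧
    (∀ v : V, {e | e ∈ dangerousPairs C ∧ ∀ u ∈ e, H.Adj v u}.encard ≤ 15) ∧
    (∀ v : V, {e | e ∈ sparselyConnectedPairs H ∧ v ∈ e}.encard ≤ 1)

theorem sqrt_log_div_mem_unitInterval (n : ℕ) :
    Real.sqrt (1.99 * Real.log n / n) ∈ unitInterval := by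
  refine ⟨Real.sqrt_nonneg _, ?_⟩
  rw [Real.sqrt_le_iff]
  refine ⟨zero_le_one, ?_⟩
  rw [one_pow]
  rcases Nat.eq_zero_or_pos n with rfl | hn
  · simp
  have hn' : (0 : ℝ) < n := by exact_mod_cast hn
  rw [div_le_one hn']
  have hs : 0 < Real.sqrt n := Real.sqrt_pos.2 hn'
  have h1 : Real.log n = 2 * Real.log (Real.sqrt n) := by
    rw [Real.log_sqrt hn'.le]; ring
  have h2 := Real.log_le_sub_one_of_pos hs
  have h3 := Real.sq_sqrt hn'.le
  nlinarith [sq_nonneg (Real.sqrt n - 1.99)]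

/-- The edge probability `√(1.99 log n / n)`, as an element of `[0, 1]`. -/
noncomputable def edgeProb (n : ℕ) : unitInterval :=
  ⟨Real.sqrt (1.99 * Real.log n / n), sqrt_log_div_mem_unitInterval n⟩

end RainbowGraph

/-! One may take H = G, and each of the bounds 3, 15 and 1 is met with room: at most one pair in
every case. Write L = log n. A pair of vertices has on average about n p² = 1.99 L common
neighbours. Call a pair low if it has fewer than 0.01 L of them, and middling if fewer than 0.73 L.

Since 1.99 < 2, a union bound over pairs cannot exclude low pairs, but low pairs are scattered. For
boundedly many pairs the lower-tail bounds multiply as if the pairs were independent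
(`real_outerCodegree_le`), each low pair costing n^(-1.695). Up to logarithms, two low pairs at one
vertex then have probability n^(3-3.39), and two disjoint low pairs inside one neighbourhood n^5 p^4
n^(-3.39) = n^(-0.39). So it is enough to colour G such that every pair that is not low has more
than 66 rainbow 2-paths: dangerous pairs are then low, and all three conditions follow
(`propertyM_of_coloring`).

The colouring comes from an asymmetric local lemma (`exists_forall_notMem`). A pair with d common
neighbours fails in a random colouring with probability about 2^(-d), up to a constant. Its event
meets those of roughly pn, about n^(1/2), other pairs through each relevant edge, far too many if
all could fail with probability n^(-0.0069). However, for fixed s ≠ t at most 99 neighbours w of t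
make {s, w} middling; all other pairs fail with probability at most about n^(-0.505), which just
beats the degree. The weighted sum over dependent events therefore tends to 0 (`exists_coloring`).
-/

namespace RainbowGraph

open MeasureTheory ProbabilityTheory

variable {V : Type*}

/-! ### Independence of disjoint edge sets in the random graph -/

/-- The value of `f` at a graph is determined by which elements of `A` are edges. -/
def EdgeDetermined {β : Type*} (f : SimpleGraph V → β) (A : Set (Sym2 V)) : Prop :=
  ∀ G G' : SimpleGraph V, (∀ e ∈ A, e ∈ G.edgeSet ↔ e ∈ G'.edgeSet) → f G = f G'

theorem EdgeDetermined.mono {β : Type*} {f : SimpleGraph V → β} {A B : Set (Sym2 V)}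
    (hf : EdgeDetermined f A) (h : A ⊆ B) : EdgeDetermined f B :=
  fun G G' hG => hf G G' fun e he => hG e (h he)

theorem EdgeDetermined.prod {ι : Type*} {s : Finset ι} {f : ι → SimpleGraph V → ℝ}
    {A : Set (Sym2 V)} (hf : ∀ i ∈ s, EdgeDetermined (f i) A) :
    EdgeDetermined (fun G => ∏ i ∈ s, f i G) A :=
  fun G G' hG => Finset.prod_congr rfl fun i hi => hf i hi G G' hG

instance [Finite V] : MeasurableSingletonClass (SimpleGraph V) where
  measurableSet_singleton G := by
    have : ({G} : Set (SimpleGraph V)) = SimpleGraph.edgeSet ⁻¹' {G.edgeSet} := by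
      ext H; simp
    rw [this]
    exact SimpleGraph.measurable_edgeSet (measurableSet_singleton _)

theorem integral_binomialRandom [Finite V] (p : unitInterval) (f : SimpleGraph V → ℝ) :
    ∫ G, f G ∂(SimpleGraph.binomialRandom V p) =
      ∫ ω, f (SimpleGraph.fromEdgeSet {e | ω e}) ∂(Measure.infinitePi fun e : Sym2 V =>
        unitInterval.toNNReal p • Measure.dirac (e ∈ (Sym2.diagSet : Set (Sym2 V))ᶜ) +
          unitInterval.toNNReal (unitInterval.symm p) • Measure.dirac False) := by
  rw [SimpleGraph.binomialRandom_eq_map, setBernoulli_eq_map,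
    Measure.map_map (by fun_prop) (Measurable.of_discrete),
    integral_map (Measurable.of_discrete).aemeasurable
      (Measurable.of_discrete).aestronglyMeasurable]
  rfl

/-- Edges are independent coordinates of a product measure, so functions read off from disjoint sets
of coordinates are independent. -/
theorem integral_mul_of_disjoint [Finite V] (p : unitInterval) {f g : SimpleGraph V → ℝ}
    {A B : Set (Sym2 V)} (hf : EdgeDetermined f A) (hg : EdgeDetermined g B)
    (hAB : Disjoint A B) :
    ∫ G, f G * g G ∂(SimpleGraph.binomialRandom V p) =
      (∫ G, f G ∂(SimpleGraph.binomialRandom V p)) *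
        ∫ G, g G ∂(SimpleGraph.binomialRandom V p) := by
  classical
  have := Fintype.ofFinite V
  simp only [integral_binomialRandom]
  set ν := Measure.infinitePi fun e : Sym2 V =>
        unitInterval.toNNReal p • Measure.dirac (e ∈ (Sym2.diagSet : Set (Sym2 V))ᶜ) +
          unitInterval.toNNReal (unitInterval.symm p) • Measure.dirac False with hν
  have hind : iIndepFun (fun (e : Sym2 V) (ω : Sym2 V → Prop) => ω e) ν :=
    iIndepFun_infinitePi (X := fun _ x => x) (fun _ => measurable_id)
  have hfin := hind.indepFun_finset A.toFinset B.toFinset (by simpa using hAB)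
    (fun e => measurable_pi_apply e)
  -- `F h C` evaluates `h` on the graph rebuilt from the coordinates in `C` alone, every other pair
  -- being a non-edge.
  let F : (h : SimpleGraph V → ℝ) → (C : Finset (Sym2 V)) → (C → Prop) → ℝ :=
    fun h C r => h (SimpleGraph.fromEdgeSet {e | ∃ he : e ∈ C, r ⟨e, he⟩})
  have key : ∀ (h : SimpleGraph V → ℝ) (C : Set (Sym2 V)), EdgeDetermined h C →
      (fun ω : Sym2 V → Prop => h (SimpleGraph.fromEdgeSet {e | ω e})) =
        F h C.toFinset ∘ (fun ω (i : C.toFinset) => ω i) := by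
    intro h C hC
    funext ω
    apply hC
    intro e he
    simp [he]
  have := hfin.comp (φ := F f A.toFinset) (ψ := F g B.toFinset)
    (Measurable.of_discrete) (Measurable.of_discrete)
  rw [← key f A hf, ← key g B hg] at this
  exact this.integral_fun_mul_eq_mul_integral (Measurable.of_discrete).aestronglyMeasurable
    (Measurable.of_discrete).aestronglyMeasurable

theorem integral_prod_of_pairwiseDisjoint [Finite V] (p : unitInterval) {ι : Type*}
    (s : Finset ι) (f : ι → SimpleGraph V → ℝ) (A : ι → Set (Sym2 V))
    (hf : ∀ i ∈ s, EdgeDetermined (f i) (A i)) (hA : (s : Set ι).PairwiseDisjoint A) :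
    ∫ G, ∏ i ∈ s, f i G ∂(SimpleGraph.binomialRandom V p) =
      ∏ i ∈ s, ∫ G, f i G ∂(SimpleGraph.binomialRandom V p) := by
  classical
  induction s using Finset.induction_on with
  | empty => simp
  | insert a s ha ih =>
    simp only [Finset.prod_insert ha]
    rw [integral_mul_of_disjoint p (B := ⋃ i ∈ s, A i) (hf a (by simp)), ih]
    · exact fun i hi => hf i (by simp [hi])
    · exact hA.subset (by simp)
    · exact EdgeDetermined.prod fun i hi => (hf i (by simp [hi])).mono
        (Set.subset_biUnion_of_mem (u := A) (Finset.mem_coe.2 hi))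
    · simp only [Set.disjoint_iUnion_right]
      exact fun i hi => hA (by simp) (by simp [hi]) (by rintro rfl; exact ha hi)

/-- The indicator that all elements of `F` are edges. -/
noncomputable def edgesIndicator (F : Set (Sym2 V)) (G : SimpleGraph V) : ℝ :=
  {G : SimpleGraph V | F ⊆ G.edgeSet}.indicator 1 G

theorem edgeDetermined_edgesIndicator (F : Set (Sym2 V)) :
    EdgeDetermined (edgesIndicator F) F := by
  classical
  intro G G' h
  have : F ⊆ G.edgeSet ↔ F ⊆ G'.edgeSet :=
    ⟨fun H e he => (h e he).1 (H he), fun H e he => (h e he).2 (H he)⟩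
  simp [edgesIndicator, Set.indicator_apply, this]

theorem integral_edgesIndicator_singleton [Finite V] (p : unitInterval) {e : Sym2 V}
    (he : ¬ e.IsDiag) :
    ∫ G, edgesIndicator {e} G ∂(SimpleGraph.binomialRandom V p) = p := by
  classical
  rw [integral_binomialRandom]
  have h1 : (fun ω : Sym2 V → Prop => edgesIndicator {e} (SimpleGraph.fromEdgeSet {e | ω e})) =
      fun ω => (fun P : Prop => if P then (1 : ℝ) else 0) (ω e) := by
    funext ω
    simp [edgesIndicator, Set.indicator_apply, he]
  rw [h1]
  rw [← integral_map (φ := fun ω : Sym2 V → Prop => ω e)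
    (f := fun P : Prop => if P then (1 : ℝ) else 0)
    (measurable_pi_apply e).aemeasurable (Measurable.of_discrete).aestronglyMeasurable]
  rw [Measure.infinitePi_map_eval]
  rw [integral_add_measure (by simp) (by simp)]
  simp [he, NNReal.smul_def]

theorem integral_edgesIndicator [Finite V] (p : unitInterval) (F : Finset (Sym2 V))
    (hF : ∀ e ∈ F, ¬ e.IsDiag) :
    ∫ G, edgesIndicator (F : Set (Sym2 V)) G ∂(SimpleGraph.binomialRandom V p) =
      (p : ℝ) ^ F.card := by
  classical
  have h : ∀ G : SimpleGraph V,
      edgesIndicator (F : Set (Sym2 V)) G = ∏ e ∈ F, edgesIndicator {e} G := by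
    intro G
    simp only [edgesIndicator, Set.indicator_apply, Set.mem_ofPred_eq, Pi.one_apply,
      Set.singleton_subset_iff]
    rw [Finset.prod_ite_zero]
    simp [Set.subset_def]
  simp only [h]
  rw [integral_prod_of_pairwiseDisjoint p F _ (fun e => {e})
    (fun e _ => edgeDetermined_edgesIndicator _)]
  · rw [Finset.prod_congr rfl fun e he => integral_edgesIndicator_singleton p (hF e he)]
    simp
  · intro a _ b _ hab
    simpa using hab

end RainbowGraph

/-! ### Lower tails of codegrees, and degrees -/

namespace RainbowGraph

open MeasureTheory ProbabilityTheory

variable {V : Type*} [DecidableEq V]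

/-- The set of pairs formed by `x` and an element of `e`. -/
def star (e : Sym2 V) (x : V) : Finset (Sym2 V) :=
  e.toFinset.image fun u => s(u, x)

theorem star_subset_edgeSet {e : Sym2 V} {x : V} {G : SimpleGraph V} :
    (star e x : Set (Sym2 V)) ⊆ G.edgeSet ↔ ∀ u ∈ e, G.Adj u x := by
  simp [star, Set.subset_def]

theorem mem_of_mem_star {e f : Sym2 V} {x : V} (h : f ∈ star e x) : x ∈ f := by
  simp only [star, Finset.mem_image] at h
  obtain ⟨u, -, rfl⟩ := h
  simp

theorem edgesIndicator_star (e : Sym2 V) (x : V) (G : SimpleGraph V)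
    [Decidable (∀ u ∈ e, G.Adj u x)] :
    edgesIndicator (star e x : Set (Sym2 V)) G = if ∀ u ∈ e, G.Adj u x then 1 else 0 := by
  classical
  simp only [edgesIndicator, Set.indicator_apply, Set.mem_ofPred_eq, star_subset_edgeSet,
    Pi.one_apply]

theorem card_star {e : Sym2 V} (he : ¬ e.IsDiag) (x : V) : (star e x).card = 2 := by
  rw [star, Finset.card_image_of_injective _ (fun a b h => Sym2.congr_left.1 h),
    Sym2.card_toFinset_of_not_isDiag e he]

theorem not_isDiag_of_mem_star {e f : Sym2 V} {x : V} (hx : x ∉ e) (hf : f ∈ star e x) :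
    ¬ f.IsDiag := by
  simp only [star, Finset.mem_image, Sym2.mem_toFinset] at hf
  obtain ⟨u, hu, rfl⟩ := hf
  intro h
  exact hx (Sym2.mk_isDiag_iff.1 h ▸ hu)

variable [Fintype V]

open Classical in
/-- The number of vertices outside `S` adjacent to both vertices of `e`. -/
noncomputable def outerCodegree (S : Finset V) (G : SimpleGraph V) (e : Sym2 V) : ℕ :=
  (Sᶜ.filter fun x => ∀ u ∈ e, G.Adj u x).card

open Classical in
/-- The number of pairs in `P` with both vertices adjacent to `x`. -/
noncomputable def pairsSeen (P : Finset (Sym2 V)) (x : V) (G : SimpleGraph V) : ℕ :=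
  (P.filter fun e => ∀ u ∈ e, G.Adj u x).card

theorem sum_pairsSeen (P : Finset (Sym2 V)) (S : Finset V) (G : SimpleGraph V) :
    ∑ x ∈ Sᶜ, pairsSeen P x G = ∑ e ∈ P, outerCodegree S G e := by
  classical
  simp only [pairsSeen, outerCodegree, Finset.card_filter]
  rw [Finset.sum_comm]

theorem edgeDetermined_pairsSeen (P : Finset (Sym2 V)) (x : V) :
    EdgeDetermined (pairsSeen P x) {f | ∃ e ∈ P, f ∈ star e x} := by
  classical
  intro G G' h
  unfold pairsSeen
  congr 1
  apply Finset.filter_congr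
  intro e he
  refine forall₂_congr fun u hu => ?_
  have := h s(u, x) ⟨e, he, by simpa [star] using ⟨u, hu, Or.inl rfl⟩⟩
  simpa using this

theorem pairsSeen_eq_sum (P : Finset (Sym2 V)) (x : V) (G : SimpleGraph V) :
    (pairsSeen P x G : ℝ) = ∑ e ∈ P, edgesIndicator (star e x : Set (Sym2 V)) G := by
  classical
  simp only [pairsSeen, edgesIndicator_star, Finset.card_filter]
  push_cast
  rfl

/-- Both sides count ordered pairs of distinct seen elements: the second factorial moment, which
controls the dependence between pairs in `P`. -/
theorem pairsSeen_sq_sub (P : Finset (Sym2 V)) (x : V) (G : SimpleGraph V) :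
    (pairsSeen P x G : ℝ) ^ 2 - pairsSeen P x G =
      ∑ q ∈ P.offDiag, edgesIndicator ((star q.1 x ∪ star q.2 x : Finset (Sym2 V)) : Set (Sym2 V)) G := by
  classical
  have h1 : ∀ q : Sym2 V × Sym2 V,
      edgesIndicator ((star q.1 x ∪ star q.2 x : Finset (Sym2 V)) : Set (Sym2 V)) G =
        edgesIndicator (star q.1 x : Set (Sym2 V)) G *
          edgesIndicator (star q.2 x : Set (Sym2 V)) G := by
    intro q
    simp only [edgesIndicator, Set.indicator_apply, Set.mem_ofPred_eq, Finset.coe_union,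
      Set.union_subset_iff, Pi.one_apply]
    split_ifs <;> simp_all
  simp only [h1]
  have h2 := Finset.sum_product P P (fun q : Sym2 V × Sym2 V =>
        edgesIndicator (star q.1 x : Set (Sym2 V)) G *
          edgesIndicator (star q.2 x : Set (Sym2 V)) G)
  rw [← Finset.diag_union_offDiag, Finset.sum_union (Finset.disjoint_diag_offDiag _)] at h2
  simp only [← Finset.sum_mul_sum] at h2
  rw [← pairsSeen_eq_sum, Finset.sum_diag] at h2
  have h3 : ∑ e ∈ P, edgesIndicator (star e x : Set (Sym2 V)) G *
          edgesIndicator (star e x : Set (Sym2 V)) G = pairsSeen P x G := by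
    rw [pairsSeen_eq_sum]
    refine Finset.sum_congr rfl fun e _ => ?_
    rw [edgesIndicator_star]
    split_ifs <;> simp
  rw [h3] at h2
  linarith

/-- Equality holds for Y = 0 and Y = 1; for Y ≥ 2 the right side is at least 1 because Y² - 2Y ≥ 0.
This reduces the generating function of `pairsSeen` to two moments. -/
theorem pow_le_quadratic {z : ℝ} (h0 : 0 ≤ z) (h1 : z ≤ 1) (Y : ℕ) :
    z ^ Y ≤ 1 - (1 - z) * Y + ((Y : ℝ) ^ 2 - Y) := by
  rcases Y with _ | _ | Y
  · simp
  · simp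
  · have : z ^ (Y + 1 + 1) ≤ 1 := pow_le_one₀ h0 h1
    push_cast
    nlinarith [mul_nonneg h0 (Nat.cast_nonneg (α := ℝ) Y), Nat.cast_nonneg (α := ℝ) Y]

-- Distinct pairs have distinct stars, each of size two. Hence seeing both costs at least p³, and n
-- p³ is negligible.
omit [Fintype V] in
theorem three_le_card_star_union {e e' : Sym2 V} (he : ¬ e.IsDiag) (he' : ¬ e'.IsDiag)
    (h : e ≠ e') (x : V) : 3 ≤ (star e x ∪ star e' x).card := by
  by_contra hc
  have h1 : star e x = star e x ∪ star e' x :=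
    Finset.eq_of_subset_of_card_le Finset.subset_union_left (by rw [card_star he]; omega)
  have h2 : star e' x = star e x ∪ star e' x :=
    Finset.eq_of_subset_of_card_le Finset.subset_union_right (by rw [card_star he']; omega)
  have h3 : star e x = star e' x := h1.trans h2.symm
  have h4 := Finset.image_injective (f := fun u : V => s(u, x)) (fun a b h => Sym2.congr_left.1 h) h3
  apply h
  ext u
  simpa using congrArg (u ∈ ·) h4

theorem integral_pow_pairsSeen_le (p : unitInterval) {P : Finset (Sym2 V)} {x : V}
    (hP : ∀ e ∈ P, ¬ e.IsDiag) (hx : ∀ e ∈ P, x ∉ e) {z : ℝ} (h0 : 0 ≤ z) (h1 : z ≤ 1) :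
    ∫ G, z ^ pairsSeen P x G ∂(SimpleGraph.binomialRandom V p) ≤
      1 - (1 - z) * P.card * (p : ℝ) ^ 2 + (P.card : ℝ) ^ 2 * (p : ℝ) ^ 3 := by
  classical
  have h2 : ∀ G : SimpleGraph V, z ^ pairsSeen P x G ≤
      1 - (1 - z) * ∑ e ∈ P, edgesIndicator (star e x : Set (Sym2 V)) G +
      ∑ q ∈ P.offDiag, edgesIndicator
        ((star q.1 x ∪ star q.2 x : Finset (Sym2 V)) : Set (Sym2 V)) G := by
    intro G
    rw [← pairsSeen_eq_sum, ← pairsSeen_sq_sub]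
    exact pow_le_quadratic h0 h1 _
  refine (integral_mono (.of_finite) (.of_finite) h2).trans ?_
  rw [integral_add .of_finite .of_finite, integral_sub .of_finite .of_finite,
    integral_const_mul, integral_finsetSum _ (fun _ _ => .of_finite),
    integral_finsetSum _ (fun _ _ => .of_finite)]
  have h3 : ∑ e ∈ P, ∫ G, edgesIndicator (star e x : Set (Sym2 V)) G
      ∂(SimpleGraph.binomialRandom V p) = P.card * (p : ℝ) ^ 2 := by
    rw [Finset.sum_congr rfl fun e he => integral_edgesIndicator p (star e x)
      fun f hf => not_isDiag_of_mem_star (hx e he) hf]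
    rw [Finset.sum_congr rfl fun e he => by rw [card_star (hP e he)]]
    simp
  have h4 : ∑ q ∈ P.offDiag, ∫ G, edgesIndicator
        ((star q.1 x ∪ star q.2 x : Finset (Sym2 V)) : Set (Sym2 V)) G
      ∂(SimpleGraph.binomialRandom V p) ≤ (P.card : ℝ) ^ 2 * (p : ℝ) ^ 3 := by
    have h5 : ∀ q ∈ P.offDiag, ∫ G, edgesIndicator
        ((star q.1 x ∪ star q.2 x : Finset (Sym2 V)) : Set (Sym2 V)) G
        ∂(SimpleGraph.binomialRandom V p) ≤ (p : ℝ) ^ 3 := by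
      intro q hq
      rw [Finset.mem_offDiag] at hq
      rw [integral_edgesIndicator]
      · exact pow_le_pow_of_le_one p.2.1 p.2.2
          (three_le_card_star_union (hP _ hq.1) (hP _ hq.2.1) hq.2.2 x)
      · intro f hf
        rcases Finset.mem_union.1 hf with hf | hf
        · exact not_isDiag_of_mem_star (hx _ hq.1) hf
        · exact not_isDiag_of_mem_star (hx _ hq.2.1) hf
    refine (Finset.sum_le_card_nsmul _ _ _ h5).trans ?_
    rw [nsmul_eq_mul]
    refine mul_le_mul_of_nonneg_right ?_ (pow_nonneg p.2.1 3)
    rw [Finset.offDiag_card]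
    calc ((P.card * P.card - P.card : ℕ) : ℝ) ≤ ((P.card * P.card : ℕ) : ℝ) := by
          exact_mod_cast Nat.sub_le _ _
      _ = _ := by push_cast; ring
  rw [h3]
  simp only [integral_const, probReal_univ, smul_eq_mul, one_mul]
  linarith

theorem real_le_integral {V : Type*} [Finite V] (p : unitInterval) (E : Set (SimpleGraph V)) {f : SimpleGraph V → ℝ}
    (h0 : ∀ G, 0 ≤ f G) (h1 : ∀ G ∈ E, 1 ≤ f G) :
    (SimpleGraph.binomialRandom V p).real E ≤ ∫ G, f G ∂(SimpleGraph.binomialRandom V p) := by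
  rw [← integral_indicator_one (E.toFinite.measurableSet)]
  refine integral_mono .of_finite .of_finite fun G => ?_
  by_cases hG : G ∈ E
  · simpa [hG] using h1 G hG
  · simpa [hG] using h0 G

/-- Exponential Markov inequality, with z = e^(-s), for the total outer codegree of `P`. Discarding
common neighbours in `S` is what makes the expectation factorise: different outer vertices use
disjoint sets of edges, all disjoint from `F`, which lies inside `S`. -/
theorem real_outerCodegree_le (p : unitInterval) {P : Finset (Sym2 V)} {S : Finset V}
    {F : Finset (Sym2 V)} (hP : ∀ e ∈ P, ¬ e.IsDiag) (hPS : ∀ e ∈ P, ∀ u ∈ e, u ∈ S)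
    (hF : ∀ f ∈ F, ¬ f.IsDiag) (hFS : ∀ f ∈ F, ∀ u ∈ f, u ∈ S) {s t : ℝ} (hs : 0 ≤ s) :
    (SimpleGraph.binomialRandom V p).real
        {G | (F : Set (Sym2 V)) ⊆ G.edgeSet ∧ ∀ e ∈ P, (outerCodegree S G e : ℝ) ≤ t} ≤
      (p : ℝ) ^ F.card * Real.exp (P.card * (s * t) - (Sᶜ.card : ℝ) *
        ((1 - Real.exp (-s)) * P.card * (p : ℝ) ^ 2 - (P.card : ℝ) ^ 2 * (p : ℝ) ^ 3)) := by
  classical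
  set z := Real.exp (-s) with hz
  have hz0 : 0 ≤ z := (Real.exp_pos _).le
  have hz1 : z ≤ 1 := by rw [hz]; simpa using hs
  have h1 := real_le_integral p
    {G | (F : Set (Sym2 V)) ⊆ G.edgeSet ∧ ∀ e ∈ P, (outerCodegree S G e : ℝ) ≤ t}
    (f := fun G => Real.exp (P.card * (s * t)) *
      (edgesIndicator (F : Set (Sym2 V)) G * ∏ x ∈ Sᶜ, z ^ pairsSeen P x G)) ?_ ?_
  · refine h1.trans ?_
    rw [integral_const_mul, integral_mul_of_disjoint p (edgeDetermined_edgesIndicator _)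
      (B := {f | ∃ x ∉ S, x ∈ f}), integral_edgesIndicator p F hF,
      integral_prod_of_pairwiseDisjoint p Sᶜ (fun x G => z ^ pairsSeen P x G)
        (fun x => {f | ∃ e ∈ P, f ∈ star e x})]
    · have h2 : ∏ x ∈ Sᶜ, ∫ G, z ^ pairsSeen P x G ∂(SimpleGraph.binomialRandom V p) ≤
          ∏ x ∈ Sᶜ, Real.exp (-((1 - z) * P.card * (p : ℝ) ^ 2 -
            (P.card : ℝ) ^ 2 * (p : ℝ) ^ 3)) := by
        refine Finset.prod_le_prod
          (fun x _ => integral_nonneg fun G => pow_nonneg hz0 _) fun x hx => ?_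
        refine (integral_pow_pairsSeen_le p hP (fun e he hxe => ?_) hz0 hz1).trans ?_
        · exact Finset.mem_compl.1 hx (hPS e he x hxe)
        · refine le_trans (le_of_eq ?_) (Real.add_one_le_exp _)
          ring
      rw [Finset.prod_const, ← Real.exp_nat_mul] at h2
      calc _ ≤ Real.exp (P.card * (s * t)) * ((p : ℝ) ^ F.card * Real.exp (Sᶜ.card *
            -((1 - z) * P.card * (p : ℝ) ^ 2 - (P.card : ℝ) ^ 2 * (p : ℝ) ^ 3))) := by
            gcongr
            exact pow_nonneg p.2.1 _
        _ = _ := by rw [mul_left_comm, ← Real.exp_add]; ring_nf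
    · intro x _ G G' h
      simp only [edgeDetermined_pairsSeen P x G G' h]
    · intro x hx y hy hxy
      refine Set.disjoint_left.2 ?_
      rintro f ⟨e, he, hf⟩ ⟨e', he', hf'⟩
      have hxf := mem_of_mem_star hf
      simp only [star, Finset.mem_image, Sym2.mem_toFinset] at hf'
      obtain ⟨u, hu, rfl⟩ := hf'
      rcases Sym2.mem_iff.1 hxf with h | h
      · exact Finset.mem_compl.1 hx (h ▸ hPS e' he' u hu)
      · exact hxy h
    · refine EdgeDetermined.prod fun x hx G G' h => ?_
      rw [edgeDetermined_pairsSeen P x G G' fun f hf => h f ?_]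
      obtain ⟨e, he, hf⟩ := hf
      exact ⟨x, Finset.mem_compl.1 hx, mem_of_mem_star hf⟩
    · refine Set.disjoint_left.2 ?_
      rintro f hf ⟨x, hx, hxf⟩
      exact hx (hFS f hf x hxf)
  · intro G
    refine mul_nonneg (Real.exp_pos _).le (mul_nonneg ?_
      (Finset.prod_nonneg fun x _ => pow_nonneg hz0 _))
    exact Set.indicator_nonneg (fun _ _ => zero_le_one) _
  · rintro G ⟨hG, hG'⟩
    have : edgesIndicator (F : Set (Sym2 V)) G = 1 := by
      simp only [edgesIndicator]
      rw [Set.indicator_of_mem (by exact hG)]; rfl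
    rw [this, one_mul, Finset.prod_pow_eq_pow_sum, sum_pairsSeen, hz, ← Real.exp_nat_mul,
      ← Real.exp_add]
    refine Real.one_le_exp ?_
    have h3 : ∑ e ∈ P, (outerCodegree S G e : ℝ) ≤ P.card * t := by
      simpa using Finset.sum_le_card_nsmul P _ t hG'
    push_cast
    nlinarith

/-- A Chernoff bound for the degree of a vertex. -/
theorem real_degree_le (p : unitInterval) (v : V) (D : ℝ) :
    (SimpleGraph.binomialRandom V p).real {G | D ≤ ((G.neighborSet v).ncard : ℝ)} ≤
      Real.exp (2 * (p * Fintype.card V) - D) := by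
  classical
  have h1 := real_le_integral p {G | D ≤ ((G.neighborSet v).ncard : ℝ)}
    (f := fun G => Real.exp (-D) *
      ∏ x ∈ {v}ᶜ, (1 + (Real.exp 1 - 1) * edgesIndicator {s(v, x)} G)) ?_ ?_
  · refine h1.trans ?_
    rw [integral_const_mul, integral_prod_of_pairwiseDisjoint p _ _ (fun x => {s(v, x)})]
    · have h2 : ∀ x ∈ ({v}ᶜ : Finset V), ∫ G, (1 + (Real.exp 1 - 1) *
          edgesIndicator {s(v, x)} G) ∂(SimpleGraph.binomialRandom V p) ≤ Real.exp (2 * p) := by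
        intro x hx
        rw [integral_add .of_finite .of_finite, integral_const_mul,
          integral_edgesIndicator_singleton p (by simpa [eq_comm] using hx)]
        simp only [integral_const, probReal_univ, smul_eq_mul, one_mul]
        -- The bound e - 1 < 2 gives 1 + (e - 1)p ≤ e^(2p).
        have := Real.exp_one_lt_d9
        have hp := p.2.1
        have h3 := Real.add_one_le_exp (2 * (p : ℝ))
        nlinarith
      have h3 : ∏ x ∈ ({v}ᶜ : Finset V), ∫ G, (1 + (Real.exp 1 - 1) *
          edgesIndicator {s(v, x)} G) ∂(SimpleGraph.binomialRandom V p) ≤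
          ∏ x ∈ ({v}ᶜ : Finset V), Real.exp (2 * p) := by
        refine Finset.prod_le_prod (fun x _ => integral_nonneg fun G => ?_) h2
        have h4 : 0 ≤ edgesIndicator {s(v, x)} G := Set.indicator_nonneg (fun _ _ => zero_le_one) _
        have := Real.exp_one_gt_d9
        have : 0 ≤ (Real.exp 1 - 1) * edgesIndicator {s(v, x)} G :=
          mul_nonneg (by linarith) h4
        simp only [Pi.zero_apply]
        linarith
      rw [Finset.prod_const, ← Real.exp_nat_mul] at h3
      have h4 : (({v}ᶜ : Finset V).card : ℝ) ≤ Fintype.card V := by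
        exact_mod_cast Finset.card_le_univ _
      have hp := p.2.1
      calc _ ≤ Real.exp (-D) * Real.exp (({v}ᶜ : Finset V).card * (2 * p)) := by gcongr
        _ = Real.exp (({v}ᶜ : Finset V).card * (2 * p) - D) := by
          rw [← Real.exp_add]; ring_nf
        _ ≤ _ := by
          refine Real.exp_le_exp.2 ?_
          nlinarith
    · intro x _ G G' h
      simp only [edgeDetermined_edgesIndicator _ G G' h]
    · intro x _ y _ hxy
      exact Set.disjoint_singleton.2 fun h => hxy (Sym2.congr_right.1 h)
  · intro G
    refine mul_nonneg (Real.exp_pos _).le (Finset.prod_nonneg fun x _ => ?_)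
    have h4 : 0 ≤ edgesIndicator {s(v, x)} G := Set.indicator_nonneg (fun _ _ => zero_le_one) _
    have := Real.exp_one_gt_d9
    have : 0 ≤ (Real.exp 1 - 1) * edgesIndicator {s(v, x)} G := mul_nonneg (by linarith) h4
    linarith
  · intro G hG
    have h2 : ∏ x ∈ ({v}ᶜ : Finset V), (1 + (Real.exp 1 - 1) * edgesIndicator {s(v, x)} G) =
        Real.exp ((G.neighborSet v).ncard) := by
      have h3 : ∀ x ∈ ({v}ᶜ : Finset V), (1 + (Real.exp 1 - 1) * edgesIndicator {s(v, x)} G) =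
          if G.Adj v x then Real.exp 1 else 1 := by
        intro x _
        simp only [edgesIndicator, Set.indicator_apply, Set.mem_ofPred_eq,
          Set.singleton_subset_iff, SimpleGraph.mem_edgeSet, Pi.one_apply]
        split_ifs <;> ring
      rw [Finset.prod_congr rfl h3, Finset.prod_ite, Finset.prod_const, Finset.prod_const_one,
        mul_one, ← Real.exp_nat_mul, mul_one]
      congr 2
      rw [← Set.ncard_coe_finset]
      congr 1
      ext x
      simp only [Finset.coe_filter, Set.mem_ofPred_eq, SimpleGraph.mem_neighborSet,
        Finset.mem_compl, Finset.mem_singleton, and_iff_right_iff_imp]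
      rintro h rfl
      exact h.ne rfl
    rw [h2, ← Real.exp_add]
    refine Real.one_le_exp ?_
    have : D ≤ ((G.neighborSet v).ncard : ℝ) := hG
    linarith

end RainbowGraph

/-! ### Local lemma for two-colourings, by counting -/

namespace RainbowGraph

section LocalLemma

variable {E ι : Type*} [Fintype E] [DecidableEq E]

/-- Exchanging the `T`-coordinates of two colourings is an involution carrying (A ∩ B) × Ω onto A ×
B. This is independence in counting form. -/
theorem card_inter_mul_card (A B : Finset (E → Bool)) (T : Finset E)
    (hA : ∀ ω ω' : E → Bool, (∀ e ∈ T, ω e = ω' e) → ω ∈ A → ω' ∈ A)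
    (hB : ∀ ω ω' : E → Bool, (∀ e ∉ T, ω e = ω' e) → ω ∈ B → ω' ∈ B) :
    (A ∩ B).card * Fintype.card (E → Bool) = A.card * B.card := by
  rw [← Finset.card_univ, ← Finset.card_product, ← Finset.card_product]
  let φ : (E → Bool) × (E → Bool) → (E → Bool) × (E → Bool) := fun q =>
    (fun e => if e ∈ T then q.1 e else q.2 e, fun e => if e ∈ T then q.2 e else q.1 e)
  have hφ : ∀ q, φ (φ q) = q := by
    intro q
    refine Prod.ext (funext fun e => ?_) (funext fun e => ?_) <;> by_cases he : e ∈ T <;>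
      simp [φ, he]
  refine Finset.card_bij' (fun q _ => φ q) (fun q _ => φ q) ?_ ?_ (fun q _ => hφ q)
    (fun q _ => hφ q)
  · intro q hq
    simp only [Finset.mem_product, Finset.mem_inter, Finset.mem_univ, and_true] at hq ⊢
    exact ⟨hA _ _ (fun e he => by simp [φ, he]) hq.1, hB _ _ (fun e he => by simp [φ, he]) hq.2⟩
  · intro q hq
    simp only [Finset.mem_product, Finset.mem_inter, Finset.mem_univ, and_true] at hq ⊢
    exact ⟨hA _ _ (fun e he => by simp [φ, he]) hq.1, hB _ _ (fun e he => by simp [φ, he]) hq.2⟩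

variable [DecidableEq ι]

/-- The colourings in none of the sets `A j`, `j ∈ S`. -/
def avoiding (A : ι → Finset (E → Bool)) (S : Finset ι) : Finset (E → Bool) :=
  Finset.univ.filter fun ω => ∀ j ∈ S, ω ∉ A j

/-- Conditioning on `avoiding A S` at most doubles the probability bound for `A i`. Without the
events Γ that share coordinates with i, the condition is independent of `A i`; by induction,
restoring Γ discards at most a fraction Σ 2 q j ≤ 1/2 of the colourings. -/
theorem card_inter_avoiding_le {I : Finset ι} {A : ι → Finset (E → Bool)} {T : ι → Finset E}
    {q : ι → ℝ}
    (hA : ∀ i ∈ I, ∀ ω ω' : E → Bool, (∀ e ∈ T i, ω e = ω' e) → ω ∈ A i → ω' ∈ A i)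
    (hq : ∀ i ∈ I, ((A i).card : ℝ) ≤ q i * Fintype.card (E → Bool))
    (hsum : ∀ i ∈ I, ∑ j ∈ I with ¬ Disjoint (T i) (T j), q j ≤ 1 / 4)
    (S : Finset ι) (hS : S ⊆ I) {i : ι} (hi : i ∈ I) :
    ((A i ∩ avoiding A S).card : ℝ) ≤ 2 * q i * (avoiding A S).card := by
  induction S using Finset.strongInduction generalizing i with
  | H S ih =>
    have hΩ : (0 : ℝ) < Fintype.card (E → Bool) := by exact_mod_cast Fintype.card_pos
    have hq0 : ∀ j ∈ I, 0 ≤ q j := fun j hj =>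
      nonneg_of_mul_nonneg_left ((Nat.cast_nonneg _).trans (hq j hj)) hΩ
    set Γ := S.filter fun j => ¬ Disjoint (T i) (T j) with hΓ
    have h1 : ((A i ∩ avoiding A S).card : ℝ) ≤ q i * (avoiding A (S \ Γ)).card := by
      have h2 : (A i ∩ avoiding A S).card ≤ (A i ∩ avoiding A (S \ Γ)).card := by
        refine Finset.card_le_card (Finset.inter_subset_inter_left ?_)
        intro ω hω
        simp only [avoiding, Finset.mem_filter, Finset.mem_univ, true_and] at hω ⊢
        exact fun j hj => hω j (Finset.mem_sdiff.1 hj).1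
      have h3 := card_inter_mul_card (A i) (avoiding A (S \ Γ)) (T i) (hA i hi) (by
        intro ω ω' h hω
        simp only [avoiding, Finset.mem_filter, Finset.mem_univ, true_and] at hω ⊢
        intro j hj hj'
        refine hω j hj (hA j (hS (Finset.mem_sdiff.1 hj).1) ω' ω (fun e he => ?_) hj')
        refine (h e fun he' => ?_).symm
        have hd : Disjoint (T i) (T j) := by
          by_contra hd
          exact (Finset.mem_sdiff.1 hj).2 (Finset.mem_filter.2 ⟨(Finset.mem_sdiff.1 hj).1, hd⟩)
        exact Finset.disjoint_left.1 hd he' he)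
      have h4 : ((A i ∩ avoiding A (S \ Γ)).card : ℝ) * Fintype.card (E → Bool) =
          (A i).card * (avoiding A (S \ Γ)).card := by exact_mod_cast h3
      have h5 : ((A i ∩ avoiding A (S \ Γ)).card : ℝ) ≤ q i * (avoiding A (S \ Γ)).card := by
        refine le_of_mul_le_mul_right ?_ hΩ
        rw [h4]
        calc _ ≤ q i * Fintype.card (E → Bool) * (avoiding A (S \ Γ)).card := by
              gcongr; exact hq i hi
          _ = _ := by ring
      exact (Nat.cast_le.2 h2).trans h5
    have h6 : ((avoiding A (S \ Γ)).card : ℝ) ≤ (avoiding A S).card +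
        ∑ j ∈ Γ, ((A j ∩ avoiding A (S \ Γ)).card : ℝ) := by
      have : avoiding A (S \ Γ) ⊆ avoiding A S ∪ Γ.biUnion fun j => A j ∩ avoiding A (S \ Γ) := by
        intro ω hω
        by_cases h : ω ∈ avoiding A S
        · exact Finset.mem_union_left _ h
        · refine Finset.mem_union_right _ (Finset.mem_biUnion.2 ?_)
          have hω' := hω
          simp only [avoiding, Finset.mem_filter, Finset.mem_univ, true_and] at h hω
          push Not at h
          obtain ⟨j, hj, hjω⟩ := h
          refine ⟨j, ?_, Finset.mem_inter.2 ⟨hjω, hω'⟩⟩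
          by_contra hjΓ
          exact hω j (Finset.mem_sdiff.2 ⟨hj, hjΓ⟩) hjω
      have := (Finset.card_le_card this).trans
        ((Finset.card_union_le _ _).trans (Nat.add_le_add_left Finset.card_biUnion_le _))
      exact_mod_cast this
    have h7 : ∑ j ∈ Γ, ((A j ∩ avoiding A (S \ Γ)).card : ℝ) ≤
        ∑ j ∈ Γ, 2 * q j * (avoiding A (S \ Γ)).card := by
      refine Finset.sum_le_sum fun j hj => ?_
      refine ih (S \ Γ) ?_ (Finset.sdiff_subset.trans hS) (hS (Finset.mem_filter.1 hj).1)
      exact Finset.sdiff_ssubset (Finset.filter_subset _ _) ⟨j, hj⟩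
    have h8 : ∑ j ∈ Γ, q j ≤ 1 / 4 := by
      refine le_trans ?_ (hsum i hi)
      refine Finset.sum_le_sum_of_subset_of_nonneg (Finset.filter_subset_filter _ hS) ?_
      exact fun j hj _ => hq0 j (Finset.mem_filter.1 hj).1
    rw [← Finset.sum_mul, ← Finset.mul_sum] at h7
    have h9 : (0 : ℝ) ≤ (avoiding A (S \ Γ)).card := Nat.cast_nonneg _
    have h10 : ((avoiding A (S \ Γ)).card : ℝ) ≤ 2 * (avoiding A S).card := by nlinarith
    have := mul_le_mul_of_nonneg_left h10 (hq0 i hi)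
    linarith

/-- An asymmetric form of the Lovász local lemma for uniformly random two-colourings. -/
theorem exists_forall_notMem {I : Finset ι} {A : ι → Finset (E → Bool)} {T : ι → Finset E}
    {q : ι → ℝ}
    (hA : ∀ i ∈ I, ∀ ω ω' : E → Bool, (∀ e ∈ T i, ω e = ω' e) → ω ∈ A i → ω' ∈ A i)
    (hq : ∀ i ∈ I, ((A i).card : ℝ) ≤ q i * Fintype.card (E → Bool))
    (hq4 : ∀ i ∈ I, q i ≤ 1 / 4)
    (hsum : ∀ i ∈ I, ∑ j ∈ I with ¬ Disjoint (T i) (T j), q j ≤ 1 / 4) :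
    ∃ ω : E → Bool, ∀ i ∈ I, ω ∉ A i := by
  have key : ∀ S : Finset ι, S ⊆ I → 0 < (avoiding A S).card := by
    intro S
    induction S using Finset.induction_on with
    | empty =>
      intro _
      simp only [avoiding]
      rw [Finset.filter_true_of_mem (by simp)]
      exact Finset.card_pos.2 Finset.univ_nonempty
    | insert i S hiS ih =>
      intro h
      have hi : i ∈ I := h (by simp)
      have h1 := ih ((Finset.subset_insert _ _).trans h)
      have h2 := card_inter_avoiding_le hA hq hsum S ((Finset.subset_insert _ _).trans h) hi
      have h3 : avoiding A (insert i S) = avoiding A S \ A i := by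
        ext ω
        simp only [avoiding, Finset.mem_filter, Finset.mem_univ, true_and, Finset.mem_sdiff,
          Finset.forall_mem_insert]
        tauto
      rw [h3]
      have h4 := Finset.card_sdiff_add_card_inter (avoiding A S) (A i)
      rw [Finset.inter_comm] at h4
      have h5 : ((avoiding A S \ A i).card : ℝ) + (A i ∩ avoiding A S).card =
        (avoiding A S).card := by exact_mod_cast h4
      have h6 : (0 : ℝ) < (avoiding A S).card := by exact_mod_cast h1
      -- At least half of the colourings survive. `hq4` does not follow from `hsum`, whose sum omits
      -- i itself when `T i` is empty.
      have h7 : (0 : ℝ) < (avoiding A S \ A i).card := by nlinarith [hq4 i hi]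
      exact_mod_cast h7
  obtain ⟨ω, hω⟩ := Finset.card_pos.1 (key I subset_rfl)
  exact ⟨ω, by simpa [avoiding] using hω⟩

end LocalLemma

/-! ### Probability of few bichromatic pairs of edges -/

section Bichromatic

variable {E ι : Type*} [Fintype E] [DecidableEq E] [DecidableEq ι]

/-- Flipping the colour of `f a` toggles whether index a is bichromatic and affects no other index,
so each index contributes the average (1 + y)/2. Injectivity is needed for f only. -/
theorem sum_prod_bichromatic (U : Finset ι) (f g : ι → E)
    (hf : Set.InjOn f U) (hfg : ∀ i ∈ U, ∀ j ∈ U, f i ≠ g j) (y : ℝ) :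
    ∑ ω : E → Bool, ∏ i ∈ U, (if ω (f i) ≠ ω (g i) then y else 1) =
      ((1 + y) / 2) ^ U.card * Fintype.card (E → Bool) := by
  induction U using Finset.induction_on with
  | empty => simp
  | insert a U ha ih =>
    have ih := ih (hf.mono (by simp)) fun i hi j hj => hfg i (by simp [hi]) j (by simp [hj])
    let φ : (E → Bool) → (E → Bool) := fun ω => Function.update ω (f a) (!ω (f a))
    have hφ : Function.Involutive φ := fun ω => by simp [φ]
    have h1 : ∀ ω : E → Bool, ∏ i ∈ U, (if φ ω (f i) ≠ φ ω (g i) then y else 1) =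
        ∏ i ∈ U, (if ω (f i) ≠ ω (g i) then y else 1) := by
      intro ω
      refine Finset.prod_congr rfl fun i hi => ?_
      have h2 : f i ≠ f a := fun h =>
        ha (hf (by simp [hi]) (by simp) h ▸ hi)
      have h3 : g i ≠ f a := (hfg a (by simp) i (by simp [hi])).symm
      simp only [φ, Function.update_of_ne h2, Function.update_of_ne h3]
    have h4 : ∀ ω : E → Bool, (if φ ω (f a) ≠ φ ω (g a) then y else 1) +
        (if ω (f a) ≠ ω (g a) then y else 1) = 1 + y := by
      intro ω
      have h3 : g a ≠ f a := (hfg a (by simp) a (by simp)).symm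
      simp only [φ, Function.update_self, Function.update_of_ne h3]
      cases ω (f a) <;> cases ω (g a) <;> simp [add_comm]
    simp only [Finset.prod_insert ha, Finset.card_insert_of_notMem ha]
    set X : (E → Bool) → ℝ := fun ω => (if ω (f a) ≠ ω (g a) then y else 1) *
      ∏ i ∈ U, (if ω (f i) ≠ ω (g i) then y else 1) with hX
    have h5 : ∑ ω, X (φ ω) = ∑ ω, X ω := Equiv.sum_comp hφ.toPerm X
    have h6 : ∑ ω, (X (φ ω) + X ω) = (1 + y) * (((1 + y) / 2) ^ U.card *
        Fintype.card (E → Bool)) := by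
      rw [← ih, Finset.mul_sum]
      refine Finset.sum_congr rfl fun ω _ => ?_
      simp only [hX]
      rw [h1, ← add_mul, h4]
    rw [Finset.sum_add_distrib, h5] at h6
    rw [pow_succ]
    change ∑ ω, X ω = _
    linarith

/-- Markov's inequality for y^X, X being the number of bichromatic indices: X ≤ m forces y^X ≥ y^m.
-/
theorem card_few_bichromatic_le (U : Finset ι) (f g : ι → E)
    (hf : Set.InjOn f U) (hfg : ∀ i ∈ U, ∀ j ∈ U, f i ≠ g j) {y : ℝ} (hy : 0 < y) (hy1 : y ≤ 1)
    (m : ℕ) :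
    ((Finset.univ.filter fun ω : E → Bool =>
        (U.filter fun i => ω (f i) ≠ ω (g i)).card ≤ m).card : ℝ) ≤
      (y⁻¹) ^ m * ((1 + y) / 2) ^ U.card * Fintype.card (E → Bool) := by
  rw [mul_assoc, ← sum_prod_bichromatic U f g hf hfg y, Finset.mul_sum, Finset.card_filter]
  push_cast
  refine Finset.sum_le_sum fun ω _ => ?_
  rw [Finset.prod_ite, Finset.prod_const, Finset.prod_const_one, mul_one]
  split_ifs with h
  · rw [inv_pow, ← div_eq_inv_mul, one_le_div (pow_pos hy _)]
    exact pow_le_pow_of_le_one hy.le hy1 h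
  · positivity

end Bichromatic

end RainbowGraph

/-! ### Colouring a fixed graph -/

namespace RainbowGraph

variable {V : Type*}

theorem sum_biUnion_le_sum {α β : Type*} [DecidableEq α] [DecidableEq β] (s : Finset α)
    (t : α → Finset β) {f : β → ℝ} (hf : ∀ b, 0 ≤ f b) :
    ∑ b ∈ s.biUnion t, f b ≤ ∑ a ∈ s, ∑ b ∈ t a, f b := by
  induction s using Finset.induction_on with
  | empty => simp
  | insert a s ha ih =>
    rw [Finset.biUnion_insert, Finset.sum_insert ha]
    have h1 := Finset.sum_union_inter (s₁ := t a) (s₂ := s.biUnion t) (f := f)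
    have h2 : 0 ≤ ∑ b ∈ t a ∩ s.biUnion t, f b := Finset.sum_nonneg fun b _ => hf b
    linarith

/-- The two edges from `x` to the vertices of `e` have different colours. -/
def Bichromatic (ω : Sym2 V → Bool) (e : Sym2 V) (x : V) : Prop :=
  ∃ u ∈ e, ∃ w ∈ e, ω s(u, x) ≠ ω s(w, x)

theorem bichromatic_mk {ω : Sym2 V → Bool} {v w x : V} :
    Bichromatic ω s(v, w) x ↔ ω s(v, x) ≠ ω s(w, x) := by
  simp [Bichromatic, eq_comm]

/-- The 2-colouring of a graph induced by a 2-colouring of all pairs of vertices. -/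
def inducedLabeling (G : SimpleGraph V) (ω : Sym2 V → Bool) : G.EdgeLabeling (Fin 2) :=
  fun e => if ω e.1 then 1 else 0

theorem inducedLabeling_ne {G : SimpleGraph V} {ω : Sym2 V → Bool} {e f : G.edgeSet}
    (h : ω e.1 ≠ ω f.1) : inducedLabeling G ω e ≠ inducedLabeling G ω f := by
  unfold inducedLabeling
  cases he : ω e.1 <;> cases hf : ω f.1 <;> simp_all

variable [Fintype V] [DecidableEq V]

open Classical in
/-- The common neighbours of the vertices of `e`. -/
noncomputable def commonNbrs (G : SimpleGraph V) (e : Sym2 V) : Finset V :=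
  Finset.univ.filter fun x => ∀ u ∈ e, G.Adj u x

theorem mem_commonNbrs {G : SimpleGraph V} {e : Sym2 V} {x : V} :
    x ∈ commonNbrs G e ↔ ∀ u ∈ e, G.Adj u x := by
  simp [commonNbrs]

open Classical in
theorem card_bichromatic_le_encard_rainbowTwoPaths {G : SimpleGraph V} {ω : Sym2 V → Bool}
    {v w : V} (hvw : v ≠ w) (U : Finset V) (hU : U ⊆ commonNbrs G s(v, w)) :
    ((U.filter (Bichromatic ω s(v, w))).card : ℕ∞) ≤
      (rainbowTwoPaths (inducedLabeling G ω) v w).encard := by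
  rw [← Set.encard_coe_eq_coe_finsetCard]
  -- The middle vertex `getVert 1` recovers x from the path v, x, w.
  refine (Set.encard_le_encard ?_).trans
    (Set.encard_image_le (fun p : G.Path v w => p.1.getVert 1) _)
  intro x hx
  obtain ⟨hxU, hx⟩ := Finset.mem_filter.1 (Finset.mem_coe.1 hx)
  rw [bichromatic_mk] at hx
  have hadj := mem_commonNbrs.1 (hU hxU)
  have h1 : G.Adj v x := hadj v (by simp)
  have h2 : G.Adj x w := (hadj w (by simp)).symm
  refine ⟨⟨.cons h1 (.cons h2 .nil), by
    simp [SimpleGraph.Walk.cons_isPath_iff, h1.ne, h2.ne, hvw]⟩, ⟨by simp [twoPaths], ?_⟩, rfl⟩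
  intro e f he hf hef
  apply inducedLabeling_ne
  simp only [SimpleGraph.Walk.edges_cons, SimpleGraph.Walk.edges_nil, List.mem_cons,
    List.not_mem_nil, or_false] at he hf
  rw [Sym2.eq_swap (a := w)] at hx
  rcases he with rfl | rfl <;> rcases hf with rfl | rfl
  · exact absurd rfl hef
  · exact hx
  · exact hx.symm
  · exact absurd rfl hef

/-- The edges joining `e` to the vertices in `U`. -/
def starUnion (e : Sym2 V) (U : Finset V) : Finset (Sym2 V) :=
  U.biUnion (star e)

open Classical in
/-- The pairs sharing the vertex `s` with an edge `s(s, t)`, whose other vertex is adjacent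
to `t`. -/
noncomputable def pairsThrough (G : SimpleGraph V) (s t : V) : Finset (Sym2 V) :=
  (Finset.univ.filter fun w => G.Adj t w ∧ w ≠ s).image fun w => s(s, w)

theorem mem_pairsThrough {G : SimpleGraph V} {s t : V} {e : Sym2 V} (hs : s ∈ e)
    (he : ¬ e.IsDiag) (ht : t ∈ commonNbrs G e) : e ∈ pairsThrough G s t := by
  obtain ⟨w, rfl⟩ := hs
  rw [mem_commonNbrs] at ht
  simp only [pairsThrough, Finset.mem_image, Finset.mem_filter, Finset.mem_univ, true_and]
  refine ⟨w, ⟨(ht w (by simp)).symm, ?_⟩, rfl⟩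
  rintro rfl
  exact he rfl

/-- A common edge s(u, x), with u in e, occurs in the star of e' in one of two orientations: u is in
e' and x is the centre, or the reverse. Either way e' passes through one end and its other vertex is
adjacent to the other end. -/
theorem mem_biUnion_pairsThrough {G : SimpleGraph V} {e e' : Sym2 V} {U U' : Finset V}
    (he' : ¬ e'.IsDiag) (hU' : U' ⊆ commonNbrs G e')
    (h : ¬ Disjoint (starUnion e U) (starUnion e' U')) :
    e' ∈ e.toFinset.biUnion fun u => U.biUnion fun x =>
      pairsThrough G u x ∪ pairsThrough G x u := by
  obtain ⟨f, hf, hf'⟩ := Finset.not_disjoint_iff.1 h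
  simp only [starUnion, star, Finset.mem_biUnion, Finset.mem_image, Sym2.mem_toFinset] at hf hf'
  obtain ⟨x, hx, u, hu, rfl⟩ := hf
  obtain ⟨x', hx', u', hu', h⟩ := hf'
  simp only [Finset.mem_biUnion, Sym2.mem_toFinset, Finset.mem_union]
  refine ⟨u, hu, x, hx, ?_⟩
  rcases Sym2.eq_iff.1 h with ⟨rfl, rfl⟩ | ⟨rfl, rfl⟩
  · exact Or.inl (mem_pairsThrough hu' he' (hU' hx'))
  · exact Or.inr (mem_pairsThrough hu' he' (hU' hx'))

/-- The at most K pairs with fewer than b common neighbours are charged qm; every pair, of which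
there are at most Δ, is charged qh. -/
theorem sum_pairsThrough_le {G : SimpleGraph V} {b : ℕ} {K Δ qm qh : ℝ} (hqm : 0 ≤ qm)
    (hqh : 0 ≤ qh) {s t : V}
    (hK : ({w | G.Adj t w ∧ w ≠ s ∧ (commonNbrs G s(s, w)).card < b}.ncard : ℝ) ≤ K)
    (hΔ : ((G.neighborSet t).ncard : ℝ) ≤ Δ) :
    ∑ e ∈ pairsThrough G s t, (if b ≤ (commonNbrs G e).card then qh else qm) ≤
      K * qm + Δ * qh := by
  classical
  rw [pairsThrough, Finset.sum_image fun a _ b _ h => Sym2.congr_right.1 h]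
  have h1 : ∀ w, (if b ≤ (commonNbrs G s(s, w)).card then qh else qm) ≤
      (if (commonNbrs G s(s, w)).card < b then qm else 0) + qh := by
    intro w
    split_ifs <;> first | omega | linarith
  refine (Finset.sum_le_sum fun w _ => h1 w).trans ?_
  rw [Finset.sum_add_distrib, ← Finset.sum_filter, Finset.sum_const, Finset.sum_const,
    nsmul_eq_mul, nsmul_eq_mul, Finset.filter_filter]
  refine add_le_add (mul_le_mul_of_nonneg_right (le_trans (le_of_eq ?_) hK) hqm)
    (mul_le_mul_of_nonneg_right (le_trans ?_ hΔ) hqh)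
  · rw [← Set.ncard_coe_finset]
    simp [and_assoc]
  · rw [← Set.ncard_coe_finset, Nat.cast_le]
    refine Set.ncard_le_ncard (fun w hw => ?_) (Set.toFinite _)
    exact (Finset.mem_filter.1 (Finset.mem_coe.1 hw)).2.1

theorem exists_coloring {G : SimpleGraph V} {a b m : ℕ} (hab : a ≤ b) {K Δ y : ℝ}
    (hy : 0 < y) (hy1 : y ≤ 1) (hK0 : 0 ≤ K) (hΔ0 : 0 ≤ Δ)
    (hK : ∀ s t : V, s ≠ t →
      ({w | G.Adj t w ∧ w ≠ s ∧ (commonNbrs G s(s, w)).card < b}.ncard : ℝ) ≤ K)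
    (hΔ : ∀ t, ((G.neighborSet t).ncard : ℝ) ≤ Δ)
    (h4 : (y⁻¹) ^ m * ((1 + y) / 2) ^ a ≤ 1 / 4)
    (hsum : 4 * b * (K * ((y⁻¹) ^ m * ((1 + y) / 2) ^ a) +
      Δ * ((y⁻¹) ^ m * ((1 + y) / 2) ^ b)) ≤ 1 / 4) :
    ∃ ω : Sym2 V → Bool, ∀ v w : V, v ≠ w → a ≤ (commonNbrs G s(v, w)).card →
      (m : ℕ∞) < (rainbowTwoPaths (inducedLabeling G ω) v w).encard := by
  classical
  set qm := (y⁻¹) ^ m * ((1 + y) / 2) ^ a with hqm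
  set qh := (y⁻¹) ^ m * ((1 + y) / 2) ^ b with hqh
  have hqm0 : 0 ≤ qm := by positivity
  have hqh0 : 0 ≤ qh := by positivity
  have hqhm : qh ≤ qm := by
    refine mul_le_mul_of_nonneg_left ?_ (by positivity)
    exact pow_le_pow_of_le_one (by positivity) (by linarith) hab
  let q : Sym2 V → ℝ := fun e => if b ≤ (commonNbrs G e).card then qh else qm
  have hq0 : ∀ e, 0 ≤ q e := fun e => by dsimp only [q]; split_ifs <;> assumption
  let I : Finset (Sym2 V) := Finset.univ.filter fun e =>
    ¬ e.IsDiag ∧ a ≤ (commonNbrs G e).card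
  -- Each event looks only at a sample of exactly b or a common neighbours. The cap b keeps the
  -- number of edges it depends on logarithmic in the application.
  have hUex : ∀ e : Sym2 V, ∃ U ⊆ commonNbrs G e, e ∈ I →
      U.card = if b ≤ (commonNbrs G e).card then b else a := by
    intro e
    by_cases he : e ∈ I
    · have : (if b ≤ (commonNbrs G e).card then b else a) ≤ (commonNbrs G e).card := by
        split_ifs with h
        · exact h
        · exact (Finset.mem_filter.1 he).2.2
      obtain ⟨U, hU, hUc⟩ := Finset.exists_subset_card_eq this
      exact ⟨U, hU, fun _ => hUc⟩
    · exact ⟨∅, by simp, fun h => absurd h he⟩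
  choose U hU hUc using hUex
  let A : Sym2 V → Finset (Sym2 V → Bool) := fun e =>
    Finset.univ.filter fun ω => ((U e).filter (Bichromatic ω e)).card ≤ m
  have hex := exists_forall_notMem (I := I) (A := A) (T := fun e => starUnion e (U e))
    (q := q) ?_ ?_ ?_ ?_
  · obtain ⟨ω, hω⟩ := hex
    refine ⟨ω, fun v w hvw ha => ?_⟩
    have h1 := hω s(v, w) (Finset.mem_filter.2 ⟨Finset.mem_univ _, by simpa using hvw, ha⟩)
    simp only [A, Finset.mem_filter, Finset.mem_univ, true_and, not_le] at h1
    exact lt_of_lt_of_le (by exact_mod_cast h1)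
      (card_bichromatic_le_encard_rainbowTwoPaths hvw _ (hU _))
  · intro e he ω ω' h hω
    simp only [A, Finset.mem_filter, Finset.mem_univ, true_and] at hω ⊢
    refine le_trans (le_of_eq ?_) hω
    congr 1
    refine Finset.filter_congr fun x hx => ?_
    have h1 : ∀ u ∈ e, ω s(u, x) = ω' s(u, x) := fun u hu =>
      h _ (Finset.mem_biUnion.2 ⟨x, hx, Finset.mem_image.2 ⟨u, by simpa using hu, rfl⟩⟩)
    constructor
    · rintro ⟨u, hu, w, hw, huw⟩
      exact ⟨u, hu, w, hw, by rwa [h1 u hu, h1 w hw]⟩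
    · rintro ⟨u, hu, w, hw, huw⟩
      exact ⟨u, hu, w, hw, by rwa [← h1 u hu, ← h1 w hw]⟩
  · intro e he
    have h1 := hUc e he
    have h2 : q e = (y⁻¹) ^ m * ((1 + y) / 2) ^ (U e).card := by
      rw [h1]; dsimp only [q]; split_ifs <;> rfl
    rw [h2]
    have hdiag := (Finset.mem_filter.1 he).2.1
    have hUe := hU e
    induction e using Sym2.inductionOn with
    | hf v w =>
    have hvw : v ≠ w := by simpa using hdiag
    have h3 := card_few_bichromatic_le (U s(v, w)) (fun x => s(v, x)) (fun x => s(w, x))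
      (fun x _ x' _ h => Sym2.congr_right.1 h) (by
        intro x hx x' _ h
        rcases Sym2.eq_iff.1 h with ⟨h, -⟩ | ⟨-, h⟩
        · exact hvw h
        · exact (mem_commonNbrs.1 (hUe hx) w (by simp)).ne h.symm) hy hy1 m
    refine le_trans (le_of_eq ?_) h3
    simp only [A, bichromatic_mk]
  · intro e _
    dsimp only [q]
    split_ifs <;> linarith
  · intro e he
    have h1 : I.filter (fun j => ¬ Disjoint (starUnion e (U e)) (starUnion j (U j))) ⊆
        e.toFinset.biUnion fun u => (U e).biUnion fun x =>
          pairsThrough G u x ∪ pairsThrough G x u := by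
      intro j hj
      rw [Finset.mem_filter] at hj
      exact mem_biUnion_pairsThrough (Finset.mem_filter.1 hj.1).2.1 (hU j) hj.2
    refine (Finset.sum_le_sum_of_subset_of_nonneg h1 fun j _ _ => hq0 j).trans ?_
    have h2 : ∀ u ∈ e.toFinset, ∀ x ∈ U e,
        ∑ j ∈ pairsThrough G u x ∪ pairsThrough G x u, q j ≤ 2 * (K * qm + Δ * qh) := by
      intro u hu x hx
      have hux : u ≠ x := (mem_commonNbrs.1 (hU e hx) u (by simpa using hu)).ne
      have h3 := sum_pairsThrough_le hqm0 hqh0 (hK u x hux) (hΔ x)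
      have h4 := sum_pairsThrough_le hqm0 hqh0 (hK x u hux.symm) (hΔ u)
      have h5 := Finset.sum_union_inter (s₁ := pairsThrough G u x) (s₂ := pairsThrough G x u)
        (f := q)
      have h6 : 0 ≤ ∑ j ∈ pairsThrough G u x ∩ pairsThrough G x u, q j :=
        Finset.sum_nonneg fun j _ => hq0 j
      linarith
    have h7 : ((U e).card : ℝ) ≤ b := by
      rw [hUc e he]
      split_ifs
      · rfl
      · exact_mod_cast hab
    have hR : 0 ≤ K * qm + Δ * qh := by positivity
    calc _ ≤ ∑ u ∈ e.toFinset, ∑ x ∈ U e,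
          ∑ j ∈ pairsThrough G u x ∪ pairsThrough G x u, q j := by
          refine (sum_biUnion_le_sum _ _ hq0).trans (Finset.sum_le_sum fun u _ => ?_)
          exact sum_biUnion_le_sum _ _ hq0
      _ ≤ ∑ u ∈ e.toFinset, ∑ x ∈ U e, 2 * (K * qm + Δ * qh) :=
          Finset.sum_le_sum fun u hu => Finset.sum_le_sum fun x hx => h2 u hu x hx
      _ = 2 * ((U e).card * (2 * (K * qm + Δ * qh))) := by
          rw [Finset.sum_const, Finset.sum_const,
            Sym2.card_toFinset_of_not_isDiag e (Finset.mem_filter.1 he).2.1]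
          simp
      -- The factor 4b counts two vertices of e, at most b centres and two orientations of the
      -- shared edge.
      _ ≤ 4 * b * (K * qm + Δ * qh) := by nlinarith
      _ ≤ 1 / 4 := hsum

/-- Dangerous pairs are low, and sparsely connected pairs are dangerous. By `h1` low pairs are
pairwise disjoint, so `h2` leaves at most one dangerous pair inside any neighbourhood. -/
theorem propertyM_of_coloring {G : SimpleGraph V} {a : ℕ} {ω : Sym2 V → Bool}
    (hω : ∀ v w : V, v ≠ w → a ≤ (commonNbrs G s(v, w)).card →
      66 < (rainbowTwoPaths (inducedLabeling G ω) v w).encard)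
    (h1 : ∀ v w w' : V, v ≠ w → v ≠ w' → (commonNbrs G s(v, w)).card < a →
      (commonNbrs G s(v, w')).card < a → w = w')
    (h2 : ∀ (u : V) (e e' : Sym2 V), ¬ e.IsDiag → ¬ e'.IsDiag → u ∈ commonNbrs G e →
      u ∈ commonNbrs G e' → (commonNbrs G e).card < a → (commonNbrs G e').card < a →
      ∃ x ∈ e, x ∈ e') :
    PropertyM G := by
  have hlow : ∀ e ∈ dangerousPairs (inducedLabeling G ω),
      ¬ e.IsDiag ∧ (commonNbrs G e).card < a := by
    rintro e ⟨v, w, rfl, hvw, -, h⟩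
    refine ⟨by simpa using hvw, ?_⟩
    by_contra hc
    exact absurd (hω v w hvw (not_lt.1 hc)) (not_lt.2 h)
  have hsub : sparselyConnectedPairs G ⊆ dangerousPairs (inducedLabeling G ω) := by
    rintro e ⟨v, w, rfl, hvw, hadj, h⟩
    exact ⟨v, w, rfl, hvw, hadj, (Set.encard_le_encard fun p hp => hp.1).trans h⟩
  have huniq : ∀ (x : V) (e e' : Sym2 V), e ∈ dangerousPairs (inducedLabeling G ω) →
      e' ∈ dangerousPairs (inducedLabeling G ω) → x ∈ e → x ∈ e' → e = e' := by
    intro x e e' he he' hx hx'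
    obtain ⟨hd, hl⟩ := hlow e he
    obtain ⟨hd', hl'⟩ := hlow e' he'
    obtain ⟨w, rfl⟩ := hx
    obtain ⟨w', rfl⟩ := hx'
    rw [h1 x w w' (by simpa using hd) (by simpa using hd') hl hl']
  refine ⟨G, inducedLabeling G ω, le_rfl, fun v => ?_, fun v => ?_, fun v => ?_⟩
  · refine le_trans (Set.encard_le_one_iff.2 ?_) (by norm_num)
    exact fun e e' he he' => huniq v e e' he.1 he'.1 he.2 he'.2
  · refine le_trans (Set.encard_le_one_iff.2 ?_) (by norm_num)
    intro e e' he he'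
    obtain ⟨hd, hl⟩ := hlow e he.1
    obtain ⟨hd', hl'⟩ := hlow e' he'.1
    obtain ⟨x, hx, hx'⟩ := h2 v e e' hd hd' (mem_commonNbrs.2 fun u hu => (he.2 u hu).symm)
      (mem_commonNbrs.2 fun u hu => (he'.2 u hu).symm) hl hl'
    exact huniq x e e' he.1 he'.1 hx hx'
  · refine Set.encard_le_one_iff.2 ?_
    exact fun e e' he he' => huniq v e e' (hsub he.1) (hsub he'.1) he.2 he'.2

end RainbowGraph

/-! ### Asymptotics of p and the codegree tail -/

namespace RainbowGraph

open MeasureTheory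

theorem tendsto_log_pow_mul_exp_neg (r : ℕ) {c : ℝ} (hc : 0 < c) (K : ℝ) :
    Tendsto (fun n : ℕ => K * (Real.log n ^ r * Real.exp (-(c * Real.log n)))) atTop (𝓝 0) := by
  have h1 := (Real.tendsto_pow_mul_exp_neg_atTop_nhds_zero r).comp
    ((Real.tendsto_log_atTop.comp tendsto_natCast_atTop_atTop).const_mul_atTop hc)
  have h2 := h1.const_mul (K * (c ^ r)⁻¹)
  rw [mul_zero] at h2
  refine h2.congr fun n => ?_
  simp only [Function.comp_apply, mul_pow]
  field_simp

theorem eventually_one_le_log : ∀ᶠ n : ℕ in atTop, 1 ≤ Real.log n :=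
  (Real.tendsto_log_atTop.comp tendsto_natCast_atTop_atTop).eventually_ge_atTop 1

theorem natCast_eq_exp_log {n : ℕ} (hn : 1 ≤ Real.log n) : (n : ℝ) = Real.exp (Real.log n) := by
  rw [Real.exp_log]
  rcases Nat.eq_zero_or_pos n with rfl | h
  · simp at hn; linarith
  · exact_mod_cast h

theorem edgeProb_sq {n : ℕ} (hn : 1 ≤ Real.log n) :
    (edgeProb n : ℝ) ^ 2 = 1.99 * Real.log n * Real.exp (-Real.log n) := by
  change Real.sqrt _ ^ 2 = _
  rw [Real.sq_sqrt (by positivity), div_eq_mul_inv]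
  congr 1
  rw [Real.exp_neg, ← natCast_eq_exp_log hn]

theorem edgeProb_le {n : ℕ} (hn : 1 ≤ Real.log n) :
    (edgeProb n : ℝ) ≤ 2 * Real.log n * Real.exp (-(Real.log n / 2)) := by
  rw [← pow_le_pow_iff_left₀ (edgeProb n).2.1 (by positivity) two_ne_zero, edgeProb_sq hn, mul_pow,
    ← Real.exp_nat_mul]
  have h1 : ((2 : ℕ) : ℝ) * -(Real.log n / 2) = -Real.log n := by push_cast; ring
  rw [h1]
  gcongr
  nlinarith

theorem log_le_edgeProb_mul {n : ℕ} (hn : 1 ≤ Real.log n) :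
    Real.log n ≤ (edgeProb n : ℝ) * n := by
  have h0 : (0 : ℝ) < n := by rw [natCast_eq_exp_log hn]; exact Real.exp_pos _
  rw [← div_le_iff₀ h0]
  refine Real.le_sqrt_of_sq_le ?_
  have h1 : Real.log n ≤ n := (Real.log_le_sub_one_of_pos h0).trans (by linarith)
  rw [div_pow, div_le_div_iff₀ (by positivity) h0]
  have h2 : Real.log n * (n * Real.log n) ≤ n * (n * Real.log n) := by gcongr
  nlinarith

/-- Since n p² = 1.99 L, the main exponent is k(1.99(1 - e^(-s)) - sτ)L. The corrections from |S| p²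
and k² n p³ vanish; they eventually cost at most a factor e < 3. -/
theorem eventually_outerCodegree_le (k m : ℕ) {s τ c : ℝ} (hs : 0 ≤ s)
    (hc : c ≤ 1.99 * (1 - Real.exp (-s)) - s * τ) :
    ∀ᶠ n : ℕ in atTop, ∀ (P F : Finset (Sym2 (Fin n))) (S : Finset (Fin n)),
      P.card = k → S.card ≤ m → (∀ e ∈ P, ¬ e.IsDiag) → (∀ e ∈ P, ∀ u ∈ e, u ∈ S) →
      (∀ f ∈ F, ¬ f.IsDiag) → (∀ f ∈ F, ∀ u ∈ f, u ∈ S) →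
      (SimpleGraph.binomialRandom (Fin n) (edgeProb n)).real
        {G | (F : Set (Sym2 (Fin n))) ⊆ G.edgeSet ∧
          ∀ e ∈ P, (outerCodegree S G e : ℝ) ≤ τ * Real.log n} ≤
      3 * (edgeProb n : ℝ) ^ F.card * Real.exp (-(k * c * Real.log n)) := by
  have h1 := (tendsto_log_pow_mul_exp_neg 1 one_pos (m * k * 1.99)).add
    (tendsto_log_pow_mul_exp_neg 2 (half_pos one_pos) (k ^ 2 * 3.98))
  rw [add_zero] at h1
  filter_upwards [eventually_one_le_log, h1.eventually_le_const one_pos] with n hn h1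
  intro P F S hPk hSm hP hPS hF hFS
  refine (real_outerCodegree_le (edgeProb n) hP hPS hF hFS hs).trans ?_
  have hp := (edgeProb n).2.1
  set p : ℝ := (edgeProb n : ℝ) with hpdef
  set L := Real.log n
  set θ := 1 - Real.exp (-s) with hθ
  have hθ0 : 0 ≤ θ := by rw [hθ]; exact sub_nonneg.2 (by simpa using hs)
  have hθ1 : θ ≤ 1 := by rw [hθ]; linarith [Real.exp_pos (-s)]
  have hcard : (Sᶜ.card : ℝ) = n - S.card := by
    rw [Finset.card_compl, Nat.cast_sub (Finset.card_le_univ _), Fintype.card_fin]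
  have hp2 : p ^ 2 = 1.99 * L * Real.exp (-L) := edgeProb_sq hn
  have hn' : (n : ℝ) = Real.exp L := natCast_eq_exp_log hn
  have hnp2 : n * p ^ 2 = 1.99 * L := by
    calc n * p ^ 2 = 1.99 * L * (Real.exp L * Real.exp (-L)) := by
          rw [hp2, hn']; ring
      _ = 1.99 * L := by rw [← Real.exp_add, add_neg_cancel, Real.exp_zero, mul_one]
  have hple : p ≤ 2 * L * Real.exp (-(L / 2)) := edgeProb_le hn
  have hSm' : (S.card : ℝ) ≤ m := by exact_mod_cast hSm
  have hS0 : (0 : ℝ) ≤ S.card := Nat.cast_nonneg _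
  have hk0 : (0 : ℝ) ≤ k := Nat.cast_nonneg _
  rw [hPk, hcard]
  have h2 : k * (s * (τ * L)) - (n - S.card) * (θ * k * p ^ 2 - (k : ℝ) ^ 2 * p ^ 3) ≤
      1 + -(k * c * L) := by
    have e1 : k * (s * (τ * L)) - (n - S.card) * (θ * k * p ^ 2 - (k : ℝ) ^ 2 * p ^ 3) =
        k * (s * τ - 1.99 * θ) * L + S.card * (θ * k * p ^ 2) + k ^ 2 * (1.99 * L) * p -
          S.card * (k ^ 2 * p ^ 3) := by
      rw [← hnp2]
      linear_combination (-k * θ) * hnp2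
    have e2 : S.card * (θ * k * p ^ 2) ≤ m * (1 * k * p ^ 2) := by gcongr
    have e3 : k ^ 2 * (1.99 * L) * p ≤
        k ^ 2 * (1.99 * L) * (2 * L * Real.exp (-(L / 2))) := by gcongr
    have e4 : 0 ≤ S.card * (k ^ 2 * p ^ 3) :=
      mul_nonneg hS0 (mul_nonneg (sq_nonneg _) (pow_nonneg hp 3))
    have e5 : k * (s * τ - 1.99 * θ) * L ≤ -(k * c * L) := by
      have : 0 ≤ k * L * (1.99 * θ - s * τ - c) :=
        mul_nonneg (by positivity) (by linarith)
      linarith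
    have e6 : m * (1 * k * p ^ 2) + k ^ 2 * (1.99 * L) * (2 * L * Real.exp (-(L / 2))) ≤ 1 := by
      refine le_trans (le_of_eq ?_) h1
      rw [hp2]
      ring_nf
    linarith
  calc _ ≤ p ^ F.card * Real.exp (1 + -(k * c * L)) := by gcongr
    _ = Real.exp 1 * p ^ F.card * Real.exp (-(k * c * L)) := by rw [Real.exp_add]; ring
    _ ≤ _ := by
      have := Real.exp_one_lt_d9
      gcongr
      linarith

theorem real_le_card_mul {Ω ι : Type*} [MeasurableSpace Ω] (μ : Measure Ω) [IsFiniteMeasure μ]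
    [Fintype ι] {E : Set Ω} (A : ι → Set Ω) (hE : E ⊆ ⋃ i, A i) {r N : ℝ} (hr : 0 ≤ r)
    (hN : (Fintype.card ι : ℝ) ≤ N) (h : ∀ i, μ.real (A i) ≤ r) : μ.real E ≤ N * r := by
  refine (measureReal_mono hE).trans ((measureReal_iUnion_fintype_le A).trans ?_)
  refine (Finset.sum_le_card_nsmul _ _ r fun i _ => h i).trans ?_
  rw [nsmul_eq_mul]
  exact mul_le_mul_of_nonneg_right hN hr

theorem outerCodegree_le {V : Type*} [Fintype V] [DecidableEq V] (S : Finset V)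
    (G : SimpleGraph V) (e : Sym2 V) : outerCodegree S G e ≤ (commonNbrs G e).card := by
  classical
  refine Finset.card_le_card fun x hx => mem_commonNbrs.2 ?_
  exact (Finset.mem_filter.1 hx).2

theorem outerCodegree_le_of_lt_ceil {V : Type*} [Fintype V] [DecidableEq V] {S : Finset V}
    {G : SimpleGraph V} {e : Sym2 V} {x : ℝ} (h : (commonNbrs G e).card < ⌈x⌉₊) :
    (outerCodegree S G e : ℝ) ≤ x :=
  le_trans (Nat.cast_le.2 (outerCodegree_le S G e)) (Nat.lt_ceil.1 h).le

theorem exp_neg_two_le : Real.exp (-2) ≤ 0.136 := by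
  have h := Real.exp_one_gt_d9
  have h1 : Real.exp 2 = Real.exp 1 * Real.exp 1 := by rw [← Real.exp_add]; norm_num
  rw [Real.exp_neg, inv_le_comm₀ (Real.exp_pos _) (by norm_num), h1]
  nlinarith

theorem exp_neg_one_le : Real.exp (-1) ≤ 0.3679 := by
  have h := Real.exp_one_gt_d9
  rw [Real.exp_neg, inv_le_comm₀ (Real.exp_pos _) (by norm_num)]
  refine le_trans ?_ h.le
  norm_num

/-! ### Union bounds for the exceptional graphs -/

theorem eventually_real_low_low_le : ∀ᶠ n : ℕ in atTop,
    (SimpleGraph.binomialRandom (Fin n) (edgeProb n)).real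
      {G | ∃ v w w' : Fin n, v ≠ w ∧ v ≠ w' ∧ w ≠ w' ∧
        (commonNbrs G s(v, w)).card < ⌈0.01 * Real.log n⌉₊ ∧
        (commonNbrs G s(v, w')).card < ⌈0.01 * Real.log n⌉₊} ≤
      3 * (Real.log n ^ 0 * Real.exp (-(0.39 * Real.log n))) := by
  filter_upwards [eventually_one_le_log, eventually_outerCodegree_le 2 3 (s := 2) (τ := 0.01)
    (c := 1.695) (by norm_num) (by linarith [exp_neg_two_le])] with n hn h
  have hb := real_le_card_mul (SimpleGraph.binomialRandom (Fin n) (edgeProb n))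
    (ι := Fin n × Fin n × Fin n) (N := n ^ 3) (r := 3 * Real.exp (-(2 * 1.695 * Real.log n)))
    (E := {G | ∃ v w w' : Fin n, v ≠ w ∧ v ≠ w' ∧ w ≠ w' ∧
        (commonNbrs G s(v, w)).card < ⌈0.01 * Real.log n⌉₊ ∧
        (commonNbrs G s(v, w')).card < ⌈0.01 * Real.log n⌉₊})
    (fun i => {G | i.1 ≠ i.2.1 ∧ i.1 ≠ i.2.2 ∧ i.2.1 ≠ i.2.2 ∧
        (commonNbrs G s(i.1, i.2.1)).card < ⌈0.01 * Real.log n⌉₊ ∧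
        (commonNbrs G s(i.1, i.2.2)).card < ⌈0.01 * Real.log n⌉₊}) ?_ (by positivity) ?_ ?_
  · refine hb.trans (le_of_eq ?_)
    rw [natCast_eq_exp_log hn, ← Real.exp_nat_mul, Real.log_exp]
    rw [mul_left_comm, ← Real.exp_add, pow_zero, one_mul]
    congr 2
    push_cast
    ring
  · rintro G ⟨v, w, w', h⟩
    exact Set.mem_iUnion.2 ⟨(v, w, w'), h⟩
  · simp only [Fintype.card_prod, Fintype.card_fin]
    push_cast
    exact le_of_eq (by ring)
  · rintro ⟨v, w, w'⟩
    by_cases hd : v ≠ w ∧ v ≠ w' ∧ w ≠ w'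
    · have h1 := h {s(v, w), s(v, w')} ∅ {v, w, w'}
        (Finset.card_pair fun h => hd.2.2 (Sym2.congr_right.1 h)) Finset.card_le_three
        (by simp [hd.1, hd.2.1]) (by simp) (by simp) (by simp)
      refine (measureReal_mono ?_).trans (h1.trans (le_of_eq ?_))
      · rintro G ⟨-, -, -, h2, h3⟩
        refine ⟨by simp, ?_⟩
        simp only [Finset.mem_insert, Finset.mem_singleton, forall_eq_or_imp, forall_eq]
        exact ⟨outerCodegree_le_of_lt_ceil h2, outerCodegree_le_of_lt_ceil h3⟩
      · simp
    · have : {G : SimpleGraph (Fin n) | v ≠ w ∧ v ≠ w' ∧ w ≠ w' ∧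
        (commonNbrs G s(v, w)).card < ⌈0.01 * Real.log n⌉₊ ∧
        (commonNbrs G s(v, w')).card < ⌈0.01 * Real.log n⌉₊} = ∅ := by
        ext G
        simp only [Set.mem_ofPred_eq, Set.mem_empty_iff_false, iff_false]
        tauto
      simp only [this, measureReal_empty]
      positivity

theorem edgeProb_pow_le {n : ℕ} (hn : 1 ≤ Real.log n) (k : ℕ) :
    (edgeProb n : ℝ) ^ k ≤ 2 ^ k * (Real.log n ^ k * Real.exp (-(k * (Real.log n / 2)))) := by
  refine (pow_le_pow_left₀ (edgeProb n).2.1 (edgeProb_le hn) k).trans (le_of_eq ?_)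
  rw [mul_pow, mul_pow, ← Real.exp_nat_mul]
  ring_nf

/-- Five vertices, four forced edges and two low pairs give n^(5 - 2 - 3.39), up to logarithms. -/
theorem eventually_real_low_pairs_le : ∀ᶠ n : ℕ in atTop,
    (SimpleGraph.binomialRandom (Fin n) (edgeProb n)).real
      {G | ∃ (u : Fin n) (e e' : Sym2 (Fin n)), ¬ e.IsDiag ∧ ¬ e'.IsDiag ∧
        (¬ ∃ x ∈ e, x ∈ e') ∧ u ∈ commonNbrs G e ∧ u ∈ commonNbrs G e' ∧
        (commonNbrs G e).card < ⌈0.01 * Real.log n⌉₊ ∧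
        (commonNbrs G e').card < ⌈0.01 * Real.log n⌉₊} ≤
      48 * (Real.log n ^ 4 * Real.exp (-(0.39 * Real.log n))) := by
  filter_upwards [eventually_one_le_log, eventually_outerCodegree_le 2 5 (s := 2) (τ := 0.01)
    (c := 1.695) (by norm_num) (by linarith [exp_neg_two_le])] with n hn h
  have hb := real_le_card_mul (SimpleGraph.binomialRandom (Fin n) (edgeProb n))
    (ι := Fin n × Sym2 (Fin n) × Sym2 (Fin n)) (N := n ^ 5)
    (r := 3 * (2 ^ 4 * (Real.log n ^ 4 * Real.exp (-((4 : ℕ) * (Real.log n / 2))))) *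
      Real.exp (-(2 * 1.695 * Real.log n)))
    (E := {G | ∃ (u : Fin n) (e e' : Sym2 (Fin n)), ¬ e.IsDiag ∧ ¬ e'.IsDiag ∧
        (¬ ∃ x ∈ e, x ∈ e') ∧ u ∈ commonNbrs G e ∧ u ∈ commonNbrs G e' ∧
        (commonNbrs G e).card < ⌈0.01 * Real.log n⌉₊ ∧
        (commonNbrs G e').card < ⌈0.01 * Real.log n⌉₊})
    (fun i => {G | ¬ i.2.1.IsDiag ∧ ¬ i.2.2.IsDiag ∧
        (¬ ∃ x ∈ i.2.1, x ∈ i.2.2) ∧ i.1 ∈ commonNbrs G i.2.1 ∧ i.1 ∈ commonNbrs G i.2.2 ∧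
        (commonNbrs G i.2.1).card < ⌈0.01 * Real.log n⌉₊ ∧
        (commonNbrs G i.2.2).card < ⌈0.01 * Real.log n⌉₊}) ?_ (by positivity) ?_ ?_
  · refine hb.trans (le_of_eq ?_)
    have h1 : (n : ℝ) ^ 5 = Real.exp (5 * Real.log n) := by
      rw [natCast_eq_exp_log hn, ← Real.exp_nat_mul, Real.log_exp]; norm_num
    have h2 : Real.exp (-(0.39 * Real.log n)) = Real.exp (5 * Real.log n) *
        Real.exp (-((4 : ℕ) * (Real.log n / 2))) * Real.exp (-(2 * 1.695 * Real.log n)) := by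
      rw [← Real.exp_add, ← Real.exp_add]
      congr 1
      push_cast
      ring
    rw [h1, h2]
    ring
  · rintro G ⟨u, e, e', h⟩
    exact Set.mem_iUnion.2 ⟨(u, e, e'), h⟩
  · have h1 : Fintype.card (Sym2 (Fin n)) ≤ n * n := by
      have := Fintype.card_le_of_surjective (fun q : Fin n × Fin n => s(q.1, q.2)) (by
        intro e
        induction e using Sym2.inductionOn with
        | hf a b => exact ⟨(a, b), rfl⟩)
      simpa using this
    simp only [Fintype.card_prod, Fintype.card_fin]
    calc ((n * (Fintype.card (Sym2 (Fin n)) * Fintype.card (Sym2 (Fin n))) : ℕ) : ℝ) ≤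
        ((n * ((n * n) * (n * n)) : ℕ) : ℝ) := by gcongr
      _ = _ := by push_cast; ring
  · rintro ⟨u, e, e'⟩
    by_cases hd : ¬ e.IsDiag ∧ ¬ e'.IsDiag ∧ (¬ ∃ x ∈ e, x ∈ e') ∧ u ∉ e ∧ u ∉ e'
    · obtain ⟨he, he', hdisj, hu, hu'⟩ := hd
      have hne : e ≠ e' := by
        rintro rfl
        exact hdisj ⟨e.out.1, e.out_fst_mem, e.out_fst_mem⟩
      have hcard : (star e u ∪ star e' u).card = 4 := by
        rw [Finset.card_union_of_disjoint, card_star he, card_star he']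
        refine Finset.disjoint_left.2 fun f hf hf' => hdisj ?_
        simp only [star, Finset.mem_image, Sym2.mem_toFinset] at hf hf'
        obtain ⟨a, ha, rfl⟩ := hf
        obtain ⟨b, hb, hab⟩ := hf'
        rw [Sym2.congr_left] at hab
        exact ⟨a, ha, hab ▸ hb⟩
      have h1 := h {e, e'} (star e u ∪ star e' u) (insert u (e.toFinset ∪ e'.toFinset))
        (Finset.card_pair hne) ?_ (by simp [he, he']) ?_ ?_ ?_
      · refine (measureReal_mono ?_).trans (h1.trans ?_)
        · rintro G ⟨-, -, -, h4, h5, h2, h3⟩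
          refine ⟨?_, ?_⟩
          · rw [Finset.coe_union, Set.union_subset_iff]
            exact ⟨star_subset_edgeSet.2 (mem_commonNbrs.1 h4),
              star_subset_edgeSet.2 (mem_commonNbrs.1 h5)⟩
          · simp only [Finset.mem_insert, Finset.mem_singleton, forall_eq_or_imp, forall_eq]
            exact ⟨outerCodegree_le_of_lt_ceil h2, outerCodegree_le_of_lt_ceil h3⟩
        · rw [hcard]
          have := edgeProb_pow_le hn 4
          push_cast at this ⊢
          gcongr
      · refine (Finset.card_insert_le _ _).trans ?_
        have := Finset.card_union_le e.toFinset e'.toFinset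
        rw [Sym2.card_toFinset_of_not_isDiag e he, Sym2.card_toFinset_of_not_isDiag e' he'] at this
        omega
      · simp only [Finset.mem_insert, Finset.mem_singleton, forall_eq_or_imp, forall_eq,
          Finset.mem_union, Sym2.mem_toFinset]
        tauto
      · intro f hf
        rcases Finset.mem_union.1 hf with hf | hf
        · exact not_isDiag_of_mem_star hu hf
        · exact not_isDiag_of_mem_star hu' hf
      · intro f hf x hx
        simp only [star, Finset.mem_union, Finset.mem_image, Sym2.mem_toFinset] at hf
        rcases hf with ⟨a, ha, rfl⟩ | ⟨a, ha, rfl⟩ <;>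
          rcases Sym2.mem_iff.1 hx with rfl | rfl <;> simp [ha]
    · have : {G : SimpleGraph (Fin n) | ¬ e.IsDiag ∧ ¬ e'.IsDiag ∧
        (¬ ∃ x ∈ e, x ∈ e') ∧ u ∈ commonNbrs G e ∧ u ∈ commonNbrs G e' ∧
        (commonNbrs G e).card < ⌈0.01 * Real.log n⌉₊ ∧
        (commonNbrs G e').card < ⌈0.01 * Real.log n⌉₊} = ∅ := by
        ext G
        simp only [Set.mem_ofPred_eq, Set.mem_empty_iff_false, iff_false]
        rintro ⟨h1, h2, h3, h4, h5, -⟩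
        exact hd ⟨h1, h2, h3, fun h => (mem_commonNbrs.1 h4 u h).ne rfl,
          fun h => (mem_commonNbrs.1 h5 u h).ne rfl⟩
      simp only [this, measureReal_empty]
      positivity

/-- Each w contributes n · p · n^(-0.526), about n^(-0.026). One hundred of them outweigh the n²
choices of s and t: 102 - 50 - 52.6 = -0.6. -/
theorem eventually_real_many_mid_le : ∀ᶠ n : ℕ in atTop,
    (SimpleGraph.binomialRandom (Fin n) (edgeProb n)).real
      {G | ∃ s t : Fin n, s ≠ t ∧ 99 < {w | G.Adj t w ∧ w ≠ s ∧
        (commonNbrs G s(s, w)).card < ⌈0.73 * Real.log n⌉₊}.ncard} ≤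
      3 * 2 ^ 100 * (Real.log n ^ 100 * Real.exp (-(0.6 * Real.log n))) := by
  filter_upwards [eventually_one_le_log, eventually_outerCodegree_le 100 102 (s := 1) (τ := 0.73)
    (c := 0.526) (by norm_num) (by linarith [exp_neg_one_le])] with n hn h
  have hb := real_le_card_mul (SimpleGraph.binomialRandom (Fin n) (edgeProb n))
    (ι := Fin n × Fin n × Finset.powersetCard 100 (Finset.univ : Finset (Fin n))) (N := n ^ 102)
    (r := 3 * (2 ^ 100 * (Real.log n ^ 100 * Real.exp (-((100 : ℕ) * (Real.log n / 2))))) *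
      Real.exp (-((100 : ℕ) * 0.526 * Real.log n)))
    (E := {G | ∃ s t : Fin n, s ≠ t ∧ 99 < {w | G.Adj t w ∧ w ≠ s ∧
        (commonNbrs G s(s, w)).card < ⌈0.73 * Real.log n⌉₊}.ncard})
    (fun i => {G | i.1 ≠ i.2.1 ∧ ∀ w ∈ i.2.2.1, G.Adj i.2.1 w ∧ w ≠ i.1 ∧
        (commonNbrs G s(i.1, w)).card < ⌈0.73 * Real.log n⌉₊}) ?_ (by positivity) ?_ ?_
  · refine hb.trans (le_of_eq ?_)
    have h1 : (n : ℝ) ^ 102 = Real.exp (102 * Real.log n) := by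
      rw [natCast_eq_exp_log hn, ← Real.exp_nat_mul, Real.log_exp]; norm_num
    have h2 : Real.exp (-(0.6 * Real.log n)) = Real.exp (102 * Real.log n) *
        Real.exp (-((100 : ℕ) * (Real.log n / 2))) *
          Real.exp (-((100 : ℕ) * 0.526 * Real.log n)) := by
      rw [← Real.exp_add, ← Real.exp_add]
      congr 1
      push_cast
      ring
    rw [h1, h2]
    ring
  · rintro G ⟨s, t, hst, hc⟩
    obtain ⟨W, hW, hWc⟩ := Set.exists_subset_card_eq (Nat.succ_le_of_lt hc)
    refine Set.mem_iUnion.2 ⟨(s, t, ⟨W.toFinite.toFinset, ?_⟩), hst, fun w hw => hW (by simpa using hw)⟩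
    rw [Finset.mem_powersetCard, ← Set.ncard_eq_toFinset_card W, hWc]
    simp
  · simp only [Fintype.card_prod, Fintype.card_fin, Fintype.card_coe, Finset.card_powersetCard,
      Finset.card_univ]
    calc ((n * (n * n.choose 100) : ℕ) : ℝ) ≤ ((n * (n * n ^ 100) : ℕ) : ℝ) := by
          gcongr
          exact Nat.choose_le_pow _ _
      _ = _ := by push_cast; ring
  · rintro ⟨s, t, ⟨W, hW⟩⟩
    have hWc : W.card = 100 := (Finset.mem_powersetCard.1 hW).2
    by_cases hd : s ≠ t ∧ s ∉ W ∧ t ∉ W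
    · obtain ⟨hst, hs, ht⟩ := hd
      have h1 := h (W.image fun w => s(s, w)) (W.image fun w => s(t, w)) (insert s (insert t W))
        ?_ ?_ ?_ ?_ ?_ ?_
      · refine (measureReal_mono ?_).trans (h1.trans ?_)
        · rintro G ⟨-, hG⟩
          refine ⟨?_, ?_⟩
          · intro f hf
            obtain ⟨w, hw, rfl⟩ := Finset.mem_image.1 (Finset.mem_coe.1 hf)
            exact (hG w hw).1
          · intro e he
            obtain ⟨w, hw, rfl⟩ := Finset.mem_image.1 he
            exact outerCodegree_le_of_lt_ceil (hG w hw).2.2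
        · rw [Finset.card_image_of_injective _ fun a b h => Sym2.congr_right.1 h, hWc]
          have := edgeProb_pow_le hn 100
          gcongr
      · rw [Finset.card_image_of_injective _ fun a b h => Sym2.congr_right.1 h, hWc]
      · refine (Finset.card_insert_le _ _).trans ?_
        have := Finset.card_insert_le t W
        omega
      · intro e he
        obtain ⟨w, hw, rfl⟩ := Finset.mem_image.1 he
        rw [Sym2.mk_isDiag_iff]
        rintro rfl
        exact hs hw
      · intro e he x hx
        obtain ⟨w, hw, rfl⟩ := Finset.mem_image.1 he
        rcases Sym2.mem_iff.1 hx with rfl | rfl <;> simp [hw]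
      · intro e he
        obtain ⟨w, hw, rfl⟩ := Finset.mem_image.1 he
        rw [Sym2.mk_isDiag_iff]
        rintro rfl
        exact ht hw
      · intro e he x hx
        obtain ⟨w, hw, rfl⟩ := Finset.mem_image.1 he
        rcases Sym2.mem_iff.1 hx with rfl | rfl <;> simp [hw]
    · have : {G : SimpleGraph (Fin n) | s ≠ t ∧ ∀ w ∈ W, G.Adj t w ∧ w ≠ s ∧
        (commonNbrs G s(s, w)).card < ⌈0.73 * Real.log n⌉₊} = ∅ := by
        ext G
        simp only [Set.mem_ofPred_eq, Set.mem_empty_iff_false, iff_false]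
        rintro ⟨h1, h2⟩
        exact hd ⟨h1, fun h => (h2 s h).2.1 rfl, fun h => (h2 t h).1.ne rfl⟩
      simp only [this, measureReal_empty]
      positivity

theorem eventually_real_degree_le : ∀ᶠ n : ℕ in atTop,
    (SimpleGraph.binomialRandom (Fin n) (edgeProb n)).real
      {G | ∃ t : Fin n, 4 * (edgeProb n * n : ℝ) < ((G.neighborSet t).ncard : ℝ)} ≤
      1 * (Real.log n ^ 0 * Real.exp (-(1 * Real.log n))) := by
  filter_upwards [eventually_one_le_log] with n hn
  have hb := real_le_card_mul (SimpleGraph.binomialRandom (Fin n) (edgeProb n))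
    (ι := Fin n) (N := n) (r := Real.exp (-(2 * Real.log n)))
    (E := {G | ∃ t : Fin n, 4 * (edgeProb n * n : ℝ) < ((G.neighborSet t).ncard : ℝ)})
    (fun t => {G | 4 * (edgeProb n * n : ℝ) ≤ ((G.neighborSet t).ncard : ℝ)}) ?_
    (by positivity) (by simp) ?_
  · refine hb.trans (le_of_eq ?_)
    rw [pow_zero, one_mul, one_mul]
    conv_lhs => rw [natCast_eq_exp_log hn, Real.log_exp, ← Real.exp_add]
    congr 1
    ring
  · rintro G ⟨t, ht⟩
    exact Set.mem_iUnion.2 ⟨t, ht.le⟩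
  · intro t
    refine (real_degree_le (edgeProb n) t _).trans (Real.exp_le_exp.2 ?_)
    rw [Fintype.card_fin]
    have := log_le_edgeProb_mul hn
    linarith

/-! ### Numerical conditions for the local lemma -/

/-- Taking y = 1/1000 keeps the decay rate at least log 2 - 0.001 > 0.692; the price y^(-66) is only
a constant. -/
theorem half_pow_ceil_le {c L : ℝ} :
    ((1 + (1 / 1000 : ℝ)) / 2) ^ ⌈c * L⌉₊ ≤ Real.exp (-(0.692 * (c * L))) := by
  have h1 : ((1 + (1 / 1000 : ℝ)) / 2) ≤ Real.exp (-0.692) := by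
    rw [← Real.log_le_iff_le_exp (by norm_num), Real.log_div (by norm_num) (by norm_num)]
    have h2 := Real.log_two_gt_d9
    have h3 := Real.log_le_sub_one_of_pos (show (0 : ℝ) < 1 + 1 / 1000 by norm_num)
    norm_num at h3 ⊢
    linarith
  refine (pow_le_pow_left₀ (by norm_num) h1 _).trans ?_
  rw [← Real.exp_nat_mul]
  refine Real.exp_le_exp.2 ?_
  have := Nat.le_ceil (c * L)
  linarith

/-- The threshold 0.73 is chosen so that 0.692 · 0.73 > 0.505: the failure probability then beats
the degree, of order n^(1/2) up to logarithms. The boundedly many middling pairs need only the decay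
n^(-0.00692). -/
theorem eventually_local_lemma_conditions : ∀ᶠ n : ℕ in atTop,
    ((1 / 1000 : ℝ)⁻¹) ^ 66 * ((1 + (1 / 1000 : ℝ)) / 2) ^ ⌈0.01 * Real.log n⌉₊ ≤ 1 / 4 ∧
    4 * (⌈0.73 * Real.log n⌉₊ : ℝ) *
      (99 * (((1 / 1000 : ℝ)⁻¹) ^ 66 * ((1 + (1 / 1000 : ℝ)) / 2) ^ ⌈0.01 * Real.log n⌉₊) +
      4 * (edgeProb n * n : ℝ) *
        (((1 / 1000 : ℝ)⁻¹) ^ 66 * ((1 + (1 / 1000 : ℝ)) / 2) ^ ⌈0.73 * Real.log n⌉₊)) ≤ 1 / 4 := by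
  generalize hC : ((1 / 1000 : ℝ)⁻¹) ^ 66 = C
  have hC0 : 0 ≤ C := by rw [← hC]; positivity
  have h1 := tendsto_log_pow_mul_exp_neg 0 (c := 0.00692) (by norm_num) C
  have h2 := (tendsto_log_pow_mul_exp_neg 1 (c := 0.00692) (by norm_num) (8 * 99 * C)).add
    (tendsto_log_pow_mul_exp_neg 2 (c := 0.005) (by norm_num) (64 * C))
  rw [add_zero] at h2
  filter_upwards [eventually_one_le_log, h1.eventually_le_const (show (0 : ℝ) < 1 / 4 by norm_num),
    h2.eventually_le_const (show (0 : ℝ) < 1 / 4 by norm_num)] with n hn h1 h2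
  have hp := edgeProb_le hn
  have hn' : (n : ℝ) = Real.exp (Real.log n) := natCast_eq_exp_log hn
  have hp0 := (edgeProb n).2.1
  have hpn : (edgeProb n * n : ℝ) ≤ 2 * Real.log n * Real.exp (Real.log n / 2) := by
    calc (edgeProb n * n : ℝ) ≤ 2 * Real.log n * Real.exp (-(Real.log n / 2)) * n := by gcongr
      _ = 2 * Real.log n * (Real.exp (-(Real.log n / 2)) * Real.exp (Real.log n)) := by
        rw [← hn']; ring
      _ = _ := by rw [← Real.exp_add]; ring_nf
  set L := Real.log n
  have ha := half_pow_ceil_le (c := 0.01) (L := L)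
  have hb := half_pow_ceil_le (c := 0.73) (L := L)
  have hceil : (⌈0.73 * L⌉₊ : ℝ) ≤ 2 * L := by
    have := Nat.ceil_lt_add_one (show 0 ≤ 0.73 * L by linarith)
    linarith
  refine ⟨?_, ?_⟩
  · refine le_trans ?_ h1
    rw [pow_zero, one_mul]
    refine mul_le_mul_of_nonneg_left (ha.trans (le_of_eq ?_)) hC0
    ring_nf
  · refine le_trans ?_ h2
    calc _ ≤ 4 * (2 * L) * (99 * (C * Real.exp (-(0.692 * (0.01 * L)))) +
          4 * (2 * L * Real.exp (L / 2)) * (C * Real.exp (-(0.692 * (0.73 * L))))) := by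
          gcongr
      _ = 8 * 99 * C * (L * Real.exp (-(0.00692 * L))) +
          64 * C * (L ^ 2 * (Real.exp (L / 2) * Real.exp (-(0.692 * (0.73 * L))))) := by
          ring_nf
      _ ≤ _ := by
          rw [pow_one, ← Real.exp_add]
          gcongr
          linarith

end RainbowGraph

/-! ### Conclusion: outside four rare events the colouring exists -/

open RainbowGraph MeasureTheory in
theorem mainTheorem3 :
    Tendsto (fun n : ℕ =>
        SimpleGraph.binomialRandom (Fin n) (RainbowGraph.edgeProb n)
          {G : SimpleGraph (Fin n) | RainbowGraph.PropertyM G})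
      atTop (𝓝 1) := by
  have hlim := (((tendsto_log_pow_mul_exp_neg 0 (c := 0.39) (by norm_num) 3).add
    (tendsto_log_pow_mul_exp_neg 4 (c := 0.39) (by norm_num) 48)).add
    (tendsto_log_pow_mul_exp_neg 100 (c := 0.6) (by norm_num) (3 * 2 ^ 100))).add
    (tendsto_log_pow_mul_exp_neg 0 (c := 1) (by norm_num) 1)
  simp only [add_zero] at hlim
  have hlim' := (tendsto_const_nhds (x := (1 : ℝ))).sub hlim
  rw [sub_zero] at hlim'
  suffices h : Tendsto (fun n : ℕ => (SimpleGraph.binomialRandom (Fin n) (edgeProb n)).real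
      {G : SimpleGraph (Fin n) | PropertyM G}) atTop (𝓝 1) by
    have := ENNReal.tendsto_ofReal h
    simpa using this
  refine tendsto_of_tendsto_of_tendsto_of_le_of_le' hlim' tendsto_const_nhds ?_
    (Eventually.of_forall fun n => measureReal_le_one)
  filter_upwards [eventually_one_le_log, eventually_real_low_low_le, eventually_real_low_pairs_le,
    eventually_real_many_mid_le, eventually_real_degree_le, eventually_local_lemma_conditions]
    with n hn h1 h2 h3 h4 h5
  set μ := SimpleGraph.binomialRandom (Fin n) (edgeProb n)
  set B1 := {G : SimpleGraph (Fin n) | ∃ v w w' : Fin n, v ≠ w ∧ v ≠ w' ∧ w ≠ w' ∧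
        (commonNbrs G s(v, w)).card < ⌈0.01 * Real.log n⌉₊ ∧
        (commonNbrs G s(v, w')).card < ⌈0.01 * Real.log n⌉₊}
  set B2 := {G : SimpleGraph (Fin n) | ∃ (u : Fin n) (e e' : Sym2 (Fin n)), ¬ e.IsDiag ∧
        ¬ e'.IsDiag ∧ (¬ ∃ x ∈ e, x ∈ e') ∧ u ∈ commonNbrs G e ∧ u ∈ commonNbrs G e' ∧
        (commonNbrs G e).card < ⌈0.01 * Real.log n⌉₊ ∧
        (commonNbrs G e').card < ⌈0.01 * Real.log n⌉₊}
  set B3 := {G : SimpleGraph (Fin n) | ∃ s t : Fin n, s ≠ t ∧ 99 < {w | G.Adj t w ∧ w ≠ s ∧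
        (commonNbrs G s(s, w)).card < ⌈0.73 * Real.log n⌉₊}.ncard}
  set B4 := {G : SimpleGraph (Fin n) | ∃ t : Fin n,
    4 * (edgeProb n * n : ℝ) < ((G.neighborSet t).ncard : ℝ)}
  have hcover : Set.univ ⊆ {G | PropertyM G} ∪ (B1 ∪ B2 ∪ B3 ∪ B4) := by
    intro G _
    by_cases hG : G ∈ B1 ∪ B2 ∪ B3 ∪ B4
    · exact Or.inr hG
    refine Or.inl ?_
    simp only [Set.mem_union, not_or] at hG
    obtain ⟨⟨⟨g1, g2⟩, g3⟩, g4⟩ := hG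
    obtain ⟨ω, hω⟩ := exists_coloring (G := G) (a := ⌈0.01 * Real.log n⌉₊)
      (b := ⌈0.73 * Real.log n⌉₊) (m := 66) (K := 99) (Δ := 4 * (edgeProb n * n : ℝ))
      (y := 1 / 1000) (Nat.ceil_mono (by linarith)) (by norm_num) (by norm_num) (by norm_num)
      (by have := (edgeProb n).2.1; positivity)
      (fun s t hst => by
        by_contra hc
        exact g3 ⟨s, t, hst, by exact_mod_cast not_le.1 hc⟩)
      (fun t => by
        by_contra hc
        exact g4 ⟨t, not_le.1 hc⟩) h5.1 h5.2
    refine propertyM_of_coloring hω ?_ ?_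
    · intro v w w' hvw hvw' hl hl'
      by_contra hne
      exact g1 ⟨v, w, w', hvw, hvw', hne, hl, hl'⟩
    · intro u e e' he he' hu hu' hl hl'
      by_contra hne
      exact g2 ⟨u, e, e', he, he', hne, hu, hu', hl, hl'⟩
  have h6 : μ.real Set.univ ≤ μ.real {G | PropertyM G} + μ.real (B1 ∪ B2 ∪ B3 ∪ B4) :=
    (measureReal_mono hcover).trans (measureReal_union_le _ _)
  have h7 : μ.real (B1 ∪ B2 ∪ B3 ∪ B4) ≤ μ.real B1 + μ.real B2 + μ.real B3 + μ.real B4 := by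
    refine (measureReal_union_le _ _).trans (add_le_add_left ?_ _)
    refine (measureReal_union_le _ _).trans (add_le_add_left ?_ _)
    exact measureReal_union_le _ _
  rw [probReal_univ] at h6
  linarith
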